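/- Let $B$ be an injective self-adjoint operator on a (real or complex) Hilbert space $\mathcal H_0$. Let $\mathcal H_k$ ($k=1,2$) be $D(B^k)$ with the graph inner product, $\mathcal H_{-k}$ its dual (so $\mathcal H_0\subseteq\mathcal H_{-1}\subseteq\mathcal H_{-2}$), $\bar{\mathcal H}_1$ the completion of $D(B)$ for $\langle B\phi,B\varphi\rangle_0$, $\bar B:\bar{\mathcal H}_1\to\mathcal H_0$ the bounded extension of $B$, $\bar{\mathcal H}_2=\{\phi\in\bar{\mathcal H}_1:\bar B\phi\in D(B)\}$ with inner product $\langle\bar B\phi,\bar B\varphi\rangle_0+\langle B\bar B\phi,B\bar B\varphi\rangle_0$, and $\bar A=-B\bar B:\bar{\mathcal H}_2\to\mathcal H_0$. On $\bar{\mathcal H}_1\oplus\mathcal H_0$ let $W(\phi,\psi)=(\psi,\bar A\phi)$ with domain $\bar{\mathcal H}_2\oplus\mathcal H_1$. Let $\mathfrak h$ be a Hilbert space, $\Theta$ a bounded, positive, injective self-adjoint operator on $\mathfrak h$, $\mathfrak h_\Theta$ the space $\mathfrak h$ with the inner product $\langle\Theta\zeta,\eta\rangle_{\mathfrak h}$,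 and $\tau:\bar{\mathcal H}_2\to\mathfrak h$ bounded linear with dense range. For real $\lambda\ne0$ let $R_0(\lambda)=(B^2+\lambda^2)^{-1}$, let $\bar R_0(\lambda):\bar{\mathcal H}_1\to\bar{\mathcal H}_2$ be its bounded extension, $G(\lambda)=(\tau R_0(\lambda))^*:\mathfrak h\to\mathcal H_0$ and $\bar G(\lambda)=(\tau\bar R_0(\lambda))^*:\mathfrak h\to\bar{\mathcal H}_1$. Assume: * (H3.0) every element of $\mathfrak h$ has the form $\tau\phi-\Theta\zeta$ with $\phi\in\bar{\mathcal H}_2$, $\zeta\in\mathfrak h$; * (H3.1) $\mathrm{Ran}(\tau^*)\cap\mathcal H_{-1}=\{0\}$, where $\tau^*\zeta\in\mathcal H_{-2}$ is $\phi\mapsto\langle\zeta,\tau\phi\rangle_{\mathfrak h}$; * (H3.2) $\mathcal H_0$ and $\bar{\mathcal H}_1$ are contained in a common vector space $\mathcal V$, compatibly on $D(B)$ and with $\mathcal H_0\cap\bar{\mathcal H}_1=D(B)$. Then $G:=G(\lambda)+\lambda^2\bar G(\lambda):\mathfrak h\to\mathcal V$ does not depend on $\lambda$, and $(\phi_0,\zeta)\mapsto\phi_0+G\zeta$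 is injective on $\bar{\mathcal H}_1\times\mathfrak h$. Write $\phi=\phi_0+G\zeta_\phi$ for the elements of its range $\bar{\mathcal K}_1$, which carries the inner product $\langle\bar B\phi_0,\bar B\varphi_0\rangle_0+\langle\Theta\zeta_\phi,\zeta_\varphi\rangle_{\mathfrak h}$ (it is a Hilbert space if $\Theta$ is surjective); let $\bar{\mathcal K}_2=\{\phi\in\bar{\mathcal K}_1:\phi_0\in\bar{\mathcal H}_2\}$ and $\mathcal K_1=\bar{\mathcal K}_1\cap\mathcal H_0$. The operator $$W_\Theta(\phi,\psi)=(\psi,\bar A\phi_0),\qquad D(W_\Theta)=\{(\phi,\psi)\in\bar{\mathcal K}_2\oplus\mathcal K_1:\Theta\zeta_\phi=\tau\phi_0\},$$ on $\bar{\mathcal K}_1\oplus\mathcal H_0$ is skew-adjoint, i.e. densely defined with $W_\Theta^*=-W_\Theta$, and $-W_\Theta+\mu$ is onto for every real $\mu\neq0$. The map $U(\phi_0,\psi,\zeta)=(\phi_0+G\zeta,\psi)$ from $\bar{\mathcal H}_1\oplus\mathcal H_0\oplus\mathfrak h_\Theta$ onto $\bar{\mathcal K}_1\oplus\mathcal H_0$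 is unitary and $W_\Theta=U\tilde W_\Theta U^*$, where $\tilde W_\Theta$ is the (well-defined) operator $\tilde W_\Theta(\phi_0,\psi,\zeta)=(\psi_\lambda-\lambda^2\bar G(\lambda)\xi,\ \bar A\phi_0,\ \xi)$ on the vectors with $\phi_0\in\bar{\mathcal H}_2$, $\Theta\zeta=\tau\phi_0$ and $\psi=\psi_\lambda+G(\lambda)\xi$, $\psi_\lambda\in\mathcal H_1$, $\xi\in\mathfrak h$. The inclusion of $\bar{\mathcal H}_1\oplus\mathcal H_0$ in $\bar{\mathcal K}_1\oplus\mathcal H_0$ is isometric, $D(W)\cap D(W_\Theta)=\mathrm{Ker}(\tau)\oplus\mathcal H_1$, and $W_\Theta=W$ on this set. If this set is dense in $\bar{\mathcal H}_1\oplus\mathcal H_0$, then $W_\Theta$ is a singular perturbation of $W$ (both are skew-adjoint and they coincide on a dense subset of $\bar{\mathcal H}_1\oplus\mathcal H_0$); it is dense whenever $\tau$ is surjective. -/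

import Mathlib

open scoped InnerProductSpace

noncomputable section

namespace AbstractWave

/-! ### Skew-adjoint operators -/

section Skew

variable {𝕜 E F : Type*} [RCLike 𝕜]
variable [NormedAddCommGroup E] [InnerProductSpace 𝕜 E]
variable [NormedAddCommGroup F] [InnerProductSpace 𝕜 F]

/-- `T` is densely defined and its adjoint is `-T`. The adjoint is taken on the level of graphs, so
that the definition makes sense on an inner product space which need not be complete. -/
def IsSkewAdjoint (T : E →ₗ.[𝕜] E) : Prop :=
  Dense (T.domain : Set E) ∧ T.graph.adjoint = (-T).graph

/-- On a Hilbert space this is the usual notion. -/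
theorem isSkewAdjoint_iff [CompleteSpace E] (T : E →ₗ.[𝕜] E) :
    IsSkewAdjoint T ↔ Dense (T.domain : Set E) ∧ T.adjoint = -T := by
  refine and_congr_right fun h => ?_
  rw [← LinearPMap.adjoint_graph_eq_graph_adjoint h]
  exact ⟨LinearPMap.eq_of_eq_graph, fun h => by rw [h]⟩

/-- For `E` embedded in `F` by `J`: the skew-adjoint operator `S` on `F` is a singular perturbation
of the skew-adjoint operator `T` on `E` if the set of the vectors in both domains on which the two
operators coincide is dense in `E`. -/
def IsSingularPerturbation (J : E →ₗ[𝕜] F) (T : E →ₗ.[𝕜] E) (S : F →ₗ.[𝕜] F) : Prop :=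
  IsSkewAdjoint T ∧ IsSkewAdjoint S ∧
    Dense {x : E | ∃ (hx : x ∈ T.domain) (hJx : J x ∈ S.domain), S ⟨J x, hJx⟩ = J (T ⟨x, hx⟩)}

end Skew

/-! ### The spaces `H₁`, `H₂`, `H̄₁`, `H̄₂` of an operator `B` -/

section Spaces

variable {𝕜 H : Type*} [RCLike 𝕜] [NormedAddCommGroup H] [InnerProductSpace 𝕜 H]

/-- `B²`, on its natural domain. -/
def sq (B : H →ₗ.[𝕜] H) : H →ₗ.[𝕜] H where
  domain := (B.domain.comap B.toFun).map B.domain.subtype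
  toFun :=
    { toFun := fun x => B ⟨B ⟨x, by obtain ⟨y, -, h⟩ := x.2; exact h ▸ y.2⟩, by
        obtain ⟨y, hy, h⟩ := x.2
        have : y = ⟨x, h ▸ y.2⟩ := Subtype.ext h
        exact this ▸ hy⟩
      map_add' := fun x y => by
        rw [← B.map_add]; congr 1; ext1
        exact B.map_add ⟨x, _⟩ ⟨y, _⟩
      map_smul' := fun c x => by
        rw [RingHom.id_apply, ← B.map_smul]; congr 1; ext1
        exact B.map_smul c ⟨x, _⟩ }

theorem mem_sq_domain {B : H →ₗ.[𝕜] H} {x : H} :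
    x ∈ (sq B).domain ↔ ∃ hx : x ∈ B.domain, B ⟨x, hx⟩ ∈ B.domain := by
  constructor
  · rintro ⟨y, hy, rfl⟩; exact ⟨y.2, hy⟩
  · rintro ⟨hx, h⟩; exact ⟨⟨x, hx⟩, h, rfl⟩

theorem sq_domain_le (B : H →ₗ.[𝕜] H) : (sq B).domain ≤ B.domain :=
  fun _ hx => (mem_sq_domain.1 hx).1

/-- The domain of an operator `T`, with the inner product `⟪T x, T y⟫ + ⟪x, y⟫` of its graph. -/
def GraphDom (T : H →ₗ.[𝕜] H) : Type _ := T.domain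

instance (T : H →ₗ.[𝕜] H) : AddCommGroup (GraphDom T) := inferInstanceAs (AddCommGroup T.domain)
instance (T : H →ₗ.[𝕜] H) : Module 𝕜 (GraphDom T) := inferInstanceAs (Module 𝕜 T.domain)

/-- `x ↦ (T x, x)`. -/
def GraphDom.emb (T : H →ₗ.[𝕜] H) : GraphDom T →ₗ[𝕜] WithLp 2 (H × H) :=
  (WithLp.linearEquiv 2 𝕜 (H × H)).symm.toLinearMap ∘ₗ T.toFun.prod T.domain.subtype

instance (T : H →ₗ.[𝕜] H) : NormedAddCommGroup (GraphDom T) :=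
  NormedAddCommGroup.induced _ _ (GraphDom.emb T) fun _ _ h =>
    Subtype.ext (congrArg (fun z : WithLp 2 (H × H) => z.snd) h)
instance (T : H →ₗ.[𝕜] H) : InnerProductSpace 𝕜 (GraphDom T) := InnerProductSpace.induced (GraphDom.emb T)

/-- `H₁`: the domain of `B` with the graph inner product. -/
abbrev H1 (B : H →ₗ.[𝕜] H) : Type _ := GraphDom B

/-- `H₂`: the domain of `B²` with the graph inner product. -/
abbrev H2 (B : H →ₗ.[𝕜] H) : Type _ := GraphDom (sq B)

/-- The domain of `B` with the inner product `⟪B x, B y⟫`. -/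
def EnergyDom (B : H →ₗ.[𝕜] H) : Type _ := B.domain

instance (B : H →ₗ.[𝕜] H) : AddCommGroup (EnergyDom B) := inferInstanceAs (AddCommGroup B.domain)
instance (B : H →ₗ.[𝕜] H) : Module 𝕜 (EnergyDom B) := inferInstanceAs (Module 𝕜 B.domain)

/-- `B` as a linear map on its domain. -/
def EnergyDom.op (B : H →ₗ.[𝕜] H) : EnergyDom B →ₗ[𝕜] H := B.toFun

instance (B : H →ₗ.[𝕜] H) : SeminormedAddCommGroup (EnergyDom B) :=
  SeminormedAddCommGroup.induced _ _ (EnergyDom.op B)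
instance (B : H →ₗ.[𝕜] H) : InnerProductSpace 𝕜 (EnergyDom B) := InnerProductSpace.induced (EnergyDom.op B)

/-- `H̄₁`: the completion of the domain of `B` for the inner product `⟪B x, B y⟫`. -/
abbrev Hbar1 (B : H →ₗ.[𝕜] H) : Type _ := UniformSpace.Completion (EnergyDom B)

/-- The canonical map from the domain of `B` to `H̄₁`. -/
def toHbar1 (B : H →ₗ.[𝕜] H) : B.domain →ₗ[𝕜] Hbar1 B :=
  (UniformSpace.Completion.toComplL : EnergyDom B →L[𝕜] Hbar1 B).toLinearMap

variable [CompleteSpace H]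

/-- `B̄ : H̄₁ → H`: the bounded extension of `B`. -/
def Bbar (B : H →ₗ.[𝕜] H) : Hbar1 B →L[𝕜] H :=
  ((EnergyDom.op B).mkContinuous 1 fun x => (one_mul ‖x‖).ge).extend
    UniformSpace.Completion.toComplL

theorem Bbar_coe (B : H →ₗ.[𝕜] H) (x : B.domain) : Bbar B (toHbar1 B x) = B x :=
  ContinuousLinearMap.extend_eq _ UniformSpace.Completion.denseRange_coe
    (UniformSpace.Completion.isUniformInducing_coe (EnergyDom B)) _

theorem norm_Bbar (B : H →ₗ.[𝕜] H) (φ : Hbar1 B) : ‖Bbar B φ‖ = ‖φ‖ := by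
  induction φ using UniformSpace.Completion.induction_on with
  | hp => exact isClosed_eq (by fun_prop) (by fun_prop)
  | ih x =>
    rw [UniformSpace.Completion.norm_coe]
    exact congrArg norm (Bbar_coe B x)

/-- The vectors `φ` of `H̄₁` with `B̄ φ` in the domain of `B`. -/
def hbar2 (B : H →ₗ.[𝕜] H) : Submodule 𝕜 (Hbar1 B) := B.domain.comap (Bbar B).toLinearMap

/-- `H̄₂`: its inner product is `⟪B B̄ φ, B B̄ ψ⟫ + ⟪B̄ φ, B̄ ψ⟫`. -/
def Hbar2 (B : H →ₗ.[𝕜] H) : Type _ := hbar2 B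

instance (B : H →ₗ.[𝕜] H) : AddCommGroup (Hbar2 B) := inferInstanceAs (AddCommGroup (hbar2 B))
instance (B : H →ₗ.[𝕜] H) : Module 𝕜 (Hbar2 B) := inferInstanceAs (Module 𝕜 (hbar2 B))

/-- `φ ↦ B̄ φ`, from `H̄₂` to `H₁`. -/
def Hbar2.emb (B : H →ₗ.[𝕜] H) : Hbar2 B →ₗ[𝕜] H1 B :=
  ((Bbar B).toLinearMap.domRestrict (hbar2 B)).codRestrict B.domain fun φ => φ.2

instance (B : H →ₗ.[𝕜] H) : NormedAddCommGroup (Hbar2 B) :=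
  NormedAddCommGroup.induced _ _ (Hbar2.emb B) fun φ ψ h => Subtype.ext <| by
    have h' : Bbar B φ.1 = Bbar B ψ.1 := congrArg Subtype.val h
    rw [← sub_eq_zero, ← norm_eq_zero, ← norm_Bbar B, map_sub, h', sub_self, norm_zero]
instance (B : H →ₗ.[𝕜] H) : InnerProductSpace 𝕜 (Hbar2 B) := InnerProductSpace.induced (Hbar2.emb B)

/-- An element of `H̄₁` which lies in `H̄₂`, as an element of `H̄₂`. -/
def Hbar2.mk {B : H →ₗ.[𝕜] H} (φ : Hbar1 B) (hφ : φ ∈ hbar2 B) : Hbar2 B :=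
  (⟨φ, hφ⟩ : hbar2 B)

/-- The inclusion of `H̄₂` in `H̄₁`. -/
def Hbar2.incl (B : H →ₗ.[𝕜] H) : Hbar2 B →ₗ[𝕜] Hbar1 B := (hbar2 B).subtype

/-- `Ā = - B B̄`. -/
def Abar (B : H →ₗ.[𝕜] H) : Hbar2 B →ₗ[𝕜] H := -(B.toFun ∘ₗ Hbar2.emb B)

/-- The inclusion of the domain of `B²` in `H̄₂`. -/
def toHbar2 (B : H →ₗ.[𝕜] H) : (sq B).domain →ₗ[𝕜] Hbar2 B :=
  (toHbar1 B ∘ₗ Submodule.inclusion (sq_domain_le B)).codRestrict (hbar2 B) fun x => by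
    change Bbar B (toHbar1 B _) ∈ B.domain
    rw [Bbar_coe]
    exact (mem_sq_domain.1 x.2).2

end Spaces

/-! ### The resolvents of `B²` -/

section Resolvent

variable {𝕜 H : Type*} [RCLike 𝕜] [NormedAddCommGroup H] [InnerProductSpace 𝕜 H] [CompleteSpace H]
variable {B : H →ₗ.[𝕜] H}

theorem symm_of_sa (hB : IsSelfAdjoint B) (x y : B.domain) :
    inner 𝕜 (B x) (y : H) = inner 𝕜 (x : H) (B y) := by
  have h := LinearPMap.adjoint_isFormalAdjoint hB.dense_domain
  rw [LinearPMap.isSelfAdjoint_def.1 hB] at h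
  exact h x y

theorem mem_of_sa (hB : IsSelfAdjoint B) (y w : H)
    (h : ∀ x : B.domain, inner 𝕜 w (x : H) = inner 𝕜 y (B x)) :
    ∃ hy : y ∈ B.domain, B ⟨y, hy⟩ = w := by
  have h1 : y ∈ B.adjoint.domain := LinearPMap.mem_adjoint_domain_of_exists y ⟨w, h⟩
  have h2 := LinearPMap.adjoint_apply_eq hB.dense_domain ⟨y, h1⟩ h
  have h3 : (y, w) ∈ B.adjoint.graph := h2 ▸ B.adjoint.mem_graph ⟨y, h1⟩
  rw [LinearPMap.isSelfAdjoint_def.1 hB, LinearPMap.mem_graph_iff] at h3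
  obtain ⟨z, hz, hz'⟩ := h3
  obtain rfl : (z : H) = y := hz
  exact ⟨z.2, hz'⟩

/-- `B² + l²`, as a linear map on the domain of `B²`. -/
def sqAdd (B : H →ₗ.[𝕜] H) (l : ℝ) : (sq B).domain →ₗ[𝕜] H :=
  (sq B).toFun + ((l : 𝕜) ^ 2) • (sq B).domain.subtype

theorem norm_sqAdd (hB : IsSelfAdjoint B) (l : ℝ) (u : (sq B).domain) :
    ‖sqAdd B l u‖ ^ 2 = ‖sq B u‖ ^ 2 + 2 * l ^ 2 * ‖B ⟨u, sq_domain_le B u.2⟩‖ ^ 2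
      + l ^ 4 * ‖(u : H)‖ ^ 2 := by
  have h : sqAdd B l u = sq B u + ((l ^ 2 : ℝ) : 𝕜) • (u : H) := by
    simp [sqAdd]
  have h2 : inner 𝕜 (sq B u) (u : H) =
      inner 𝕜 (B ⟨u, sq_domain_le B u.2⟩) (B ⟨u, sq_domain_le B u.2⟩) :=
    symm_of_sa hB ⟨B ⟨u, sq_domain_le B u.2⟩, (mem_sq_domain.1 u.2).2⟩ ⟨u, sq_domain_le B u.2⟩
  rw [h, norm_add_sq (𝕜 := 𝕜), inner_smul_right, RCLike.re_ofReal_mul, h2, inner_self_eq_norm_sq,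
    norm_smul, RCLike.norm_ofReal, mul_pow, sq_abs]
  ring

theorem sqAdd_surjective (hB : IsSelfAdjoint B) {l : ℝ} (hl : l ≠ 0) :
    Function.Surjective (sqAdd B l) := by
  intro f
  have hl' : (l : 𝕜) ≠ 0 := by exact_mod_cast hl
  let q : WithLp 2 (H × H) →L[𝕜] H × H :=
    (((l : 𝕜)⁻¹ • ContinuousLinearMap.fst 𝕜 H H).prod (ContinuousLinearMap.snd 𝕜 H H)).comp
      (WithLp.prodContinuousLinearEquiv 2 𝕜 H H).toContinuousLinearMap
  let K : Submodule 𝕜 (WithLp 2 (H × H)) := B.graph.comap q.toLinearMap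
  have hK : IsClosed (K : Set (WithLp 2 (H × H))) := IsClosed.preimage q.continuous hB.isClosed
  have : CompleteSpace K := hK.completeSpace_coe
  have hmem : ∀ z : WithLp 2 (H × H), z ∈ K ↔ ((l : 𝕜)⁻¹ • z.fst, z.snd) ∈ B.graph :=
    fun z => Iff.rfl
  let p : WithLp 2 (H × H) := WithLp.toLp 2 ((l : 𝕜)⁻¹ • f, 0)
  obtain ⟨w, hw, w', hw', hp⟩ := K.exists_add_mem_mem_orthogonal p
  have hw1 := (hmem w).1 hw
  rw [LinearPMap.mem_graph_iff] at hw1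
  obtain ⟨u, hu, hBu⟩ := hw1
  have hu' : w.fst = (l : 𝕜) • (u : H) := by
    have : (u : H) = (l : 𝕜)⁻¹ • w.fst := hu
    rw [this, smul_smul, mul_inv_cancel₀ hl', one_smul]
  have hBu' : B u = w.snd := hBu
  have hp1 : (l : 𝕜)⁻¹ • f = w.fst + w'.fst := congrArg (fun z : WithLp 2 (H × H) => z.fst) hp
  have hp2 : (0 : H) = w.snd + w'.snd := congrArg (fun z : WithLp 2 (H × H) => z.snd) hp
  have key : ∀ v : B.domain, inner 𝕜 (f - ((l : 𝕜) ^ 2) • (u : H)) (v : H)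
      = inner 𝕜 (B u) (B v) := by
    intro v
    have hv : WithLp.toLp 2 ((l : 𝕜) • (v : H), B v) ∈ K := by
      rw [hmem]
      simp only [WithLp.toLp_fst, WithLp.toLp_snd, smul_smul, inv_mul_cancel₀ hl', one_smul]
      exact B.mem_graph v
    have h0 := Submodule.inner_left_of_mem_orthogonal hv hw'
    rw [WithLp.prod_inner_apply] at h0
    simp only [WithLp.ofLp_fst, WithLp.ofLp_snd] at h0
    have e1 : w'.fst = (l : 𝕜)⁻¹ • (f - ((l : 𝕜) ^ 2) • (u : H)) := by
      rw [smul_sub, hp1, hu', smul_smul, pow_two, ← mul_assoc, inv_mul_cancel₀ hl', one_mul]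
      abel
    have e2 : w'.snd = - B u := by rw [hBu']; exact (neg_eq_of_add_eq_zero_right hp2.symm).symm
    rw [e1, e2, inner_smul_left, inner_smul_right, inner_neg_left, ← mul_assoc] at h0
    simp only [map_inv₀, RCLike.conj_ofReal, inv_mul_cancel₀ hl', one_mul] at h0
    linear_combination h0
  obtain ⟨hy, hBB⟩ := mem_of_sa hB (B u) _ key
  refine ⟨⟨u, mem_sq_domain.2 ⟨u.2, hy⟩⟩, ?_⟩
  have : sq B ⟨u, mem_sq_domain.2 ⟨u.2, hy⟩⟩ = f - ((l : 𝕜) ^ 2) • (u : H) := hBB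
  simp only [sqAdd, LinearMap.add_apply, LinearMap.smul_apply, Submodule.subtype_apply]
  change sq B _ + _ = f
  rw [this, sub_add_cancel]

theorem sqAdd_injective (hB : IsSelfAdjoint B) {l : ℝ} (hl : l ≠ 0) :
    Function.Injective (sqAdd B l) := by
  rw [injective_iff_map_eq_zero]
  intro u hu
  have h := norm_sqAdd hB l u
  rw [hu, norm_zero] at h
  have h4 : 0 < l ^ 4 := by positivity
  have : l ^ 4 * ‖(u : H)‖ ^ 2 = 0 := by
    have a1 : 0 ≤ ‖sq B u‖ ^ 2 := by positivity
    have a2 : 0 ≤ 2 * l ^ 2 * ‖B ⟨u, sq_domain_le B u.2⟩‖ ^ 2 := by positivity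
    have a3 : 0 ≤ l ^ 4 * ‖(u : H)‖ ^ 2 := by positivity
    nlinarith
  have : ‖(u : H)‖ = 0 := by simpa [h4.ne', hl] using this
  exact Subtype.ext (norm_eq_zero.1 this)

/-- `R₀(l) = (B² + l²)⁻¹`, as a linear map onto the domain of `B²`. -/
def R0 (hB : IsSelfAdjoint B) {l : ℝ} (hl : l ≠ 0) : H →ₗ[𝕜] (sq B).domain :=
  (LinearEquiv.ofBijective (sqAdd B l)
    ⟨sqAdd_injective hB hl, sqAdd_surjective hB hl⟩).symm.toLinearMap

theorem sqAdd_R0 (hB : IsSelfAdjoint B) {l : ℝ} (hl : l ≠ 0) (f : H) :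
    sqAdd B l (R0 hB hl f) = f :=
  (LinearEquiv.ofBijective (sqAdd B l)
    ⟨sqAdd_injective hB hl, sqAdd_surjective hB hl⟩).apply_symm_apply f

theorem norm_H1_sq (x : H1 B) : ‖x‖ ^ 2 = ‖B (x : B.domain)‖ ^ 2 + ‖(x : B.domain).1‖ ^ 2 :=
  WithLp.prod_norm_sq_eq_of_L2 (GraphDom.emb B x)

theorem norm_H2_sq (x : H2 B) :
    ‖x‖ ^ 2 = ‖sq B (x : (sq B).domain)‖ ^ 2 + ‖(x : (sq B).domain).1‖ ^ 2 :=
  WithLp.prod_norm_sq_eq_of_L2 (GraphDom.emb (sq B) x)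

theorem norm_toHbar2_sq (x : (sq B).domain) :
    ‖toHbar2 B x‖ ^ 2 = ‖sq B x‖ ^ 2 + ‖B ⟨x, sq_domain_le B x.2⟩‖ ^ 2 := by
  have h : Hbar2.emb B (toHbar2 B x) =
      (⟨B ⟨x, sq_domain_le B x.2⟩, (mem_sq_domain.1 x.2).2⟩ : B.domain) :=
    Subtype.ext (Bbar_coe B _)
  change ‖Hbar2.emb B (toHbar2 B x)‖ ^ 2 = _
  rw [h]
  exact norm_H1_sq _

theorem norm_B_sq_le (hB : IsSelfAdjoint B) (u : (sq B).domain) :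
    ‖B ⟨u, sq_domain_le B u.2⟩‖ ^ 2 ≤ ‖sq B u‖ ^ 2 + ‖(u : H)‖ ^ 2 := by
  have h2 : inner 𝕜 (sq B u) (u : H) =
      inner 𝕜 (B ⟨u, sq_domain_le B u.2⟩) (B ⟨u, sq_domain_le B u.2⟩) :=
    symm_of_sa hB ⟨B ⟨u, sq_domain_le B u.2⟩, (mem_sq_domain.1 u.2).2⟩ ⟨u, sq_domain_le B u.2⟩
  have h3 := re_inner_le_norm (𝕜 := 𝕜) (sq B u) (u : H)
  rw [h2, inner_self_eq_norm_sq] at h3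
  nlinarith [sq_nonneg (‖sq B u‖ - ‖(u : H)‖), sq_nonneg (‖sq B u‖ + ‖(u : H)‖)]

/-- The inclusion of `H₂` in `H₁`. -/
def H2toH1 (hB : IsSelfAdjoint B) : H2 B →L[𝕜] H1 B :=
  LinearMap.mkContinuous (σ := RingHom.id 𝕜)
    (show H2 B →ₗ[𝕜] H1 B from Submodule.inclusion (sq_domain_le B)) 2 fun x => by
    refine le_of_sq_le_sq ?_ (by positivity)
    rw [norm_H1_sq, mul_pow, norm_H2_sq]
    have := norm_B_sq_le hB x
    change ‖B ⟨(show (sq B).domain from x).1, _⟩‖ ^ 2 + ‖(show (sq B).domain from x).1‖ ^ 2 ≤ _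
    nlinarith [sq_nonneg ‖sq B (x : (sq B).domain)‖, sq_nonneg ‖(x : (sq B).domain).1‖]

/-- The inclusion of `H₂` in `H̄₂`. -/
def H2toHbar2 (hB : IsSelfAdjoint B) : H2 B →L[𝕜] Hbar2 B :=
  LinearMap.mkContinuous (σ := RingHom.id 𝕜)
    (show H2 B →ₗ[𝕜] Hbar2 B from toHbar2 B) 2 fun x => by
    refine le_of_sq_le_sq ?_ (by positivity)
    have := norm_B_sq_le hB x
    have h2 := norm_toHbar2_sq (B := B) x
    rw [mul_pow, norm_H2_sq]
    change ‖toHbar2 B x‖ ^ 2 ≤ _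
    rw [h2]
    nlinarith [sq_nonneg ‖sq B (x : (sq B).domain)‖, sq_nonneg ‖(x : (sq B).domain).1‖]

/-- `R₀(l)` as a bounded operator from `H` to `H₂`. -/
def R0L (hB : IsSelfAdjoint B) {l : ℝ} (hl : l ≠ 0) : H →L[𝕜] H2 B :=
  LinearMap.mkContinuous (σ := RingHom.id 𝕜)
    (show H →ₗ[𝕜] H2 B from R0 hB hl) (1 + (l ^ 2)⁻¹) fun f => by
    refine le_of_sq_le_sq ?_ (by positivity)
    have h := norm_sqAdd hB l (R0 hB hl f)
    rw [sqAdd_R0] at h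
    rw [norm_H2_sq]
    change ‖sq B (R0 hB hl f)‖ ^ 2 + ‖(R0 hB hl f).1‖ ^ 2 ≤ _
    rw [mul_pow, h]
    have hk : 0 < (l ^ 2)⁻¹ := by positivity
    have hk2 : ((l ^ 2)⁻¹) ^ 2 * l ^ 4 = 1 := by field_simp
    have a1 : 0 ≤ ‖sq B (R0 hB hl f)‖ ^ 2 := by positivity
    have a2 : 0 ≤ 2 * l ^ 2 * ‖B ⟨R0 hB hl f, sq_domain_le B (R0 hB hl f).2⟩‖ ^ 2 := by positivity
    have a3 : 0 ≤ l ^ 4 * ‖(R0 hB hl f).1‖ ^ 2 := by positivity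
    generalize (l ^ 2)⁻¹ = k at *
    have a4 : ‖(R0 hB hl f).1‖ ^ 2 = k ^ 2 * (l ^ 4 * ‖(R0 hB hl f).1‖ ^ 2) := by
      rw [← mul_assoc, hk2, one_mul]
    generalize l ^ 4 * ‖(R0 hB hl f).1‖ ^ 2 = c at *
    generalize 2 * l ^ 2 * ‖B ⟨R0 hB hl f, sq_domain_le B (R0 hB hl f).2⟩‖ ^ 2 = b at *
    generalize ‖sq B (R0 hB hl f)‖ ^ 2 = a at *
    rw [a4]
    have : 0 ≤ (2 * k + k ^ 2) * a := by positivity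
    have : 0 ≤ (1 + k) ^ 2 * b := by positivity
    have : 0 ≤ (1 + 2 * k) * c := by positivity
    nlinarith

theorem completeSpace_Hbar2 (hB : IsSelfAdjoint B) : CompleteSpace (Hbar2 B) := by
  let f : Hbar2 B →ₗ[𝕜] WithLp 2 (H × Hbar1 B) :=
    (WithLp.linearEquiv 2 𝕜 (H × Hbar1 B)).symm.toLinearMap ∘ₗ
      (B.toFun ∘ₗ Hbar2.emb B).prod (Hbar2.incl B)
  have hf : Isometry f := AddMonoidHomClass.isometry_of_norm f fun φ => by
    have h1 : ‖φ‖ ^ 2 = _ := norm_H1_sq (Hbar2.emb B φ)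
    have h2 := WithLp.prod_norm_sq_eq_of_L2 (f φ)
    have h3 : ‖Bbar B (Hbar2.incl B φ)‖ = _ := norm_Bbar B (Hbar2.incl B φ)
    have h4 : ‖f φ‖ ^ 2 = ‖φ‖ ^ 2 := by
      rw [h1, h2]
      change ‖B (Hbar2.emb B φ)‖ ^ 2 + ‖Hbar2.incl B φ‖ ^ 2 =
        ‖B (Hbar2.emb B φ)‖ ^ 2 + ‖Bbar B (Hbar2.incl B φ)‖ ^ 2
      rw [h3]
    exact (sq_eq_sq₀ (norm_nonneg _) (norm_nonneg _)).1 h4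
  rw [completeSpace_iff_isComplete_range hf.isUniformInducing]
  let q : WithLp 2 (H × Hbar1 B) → H × H := fun z => (Bbar B z.snd, z.fst)
  have hq : Continuous q := by fun_prop
  have hr : Set.range f = q ⁻¹' (B.graph : Set (H × H)) := by
    ext z
    constructor
    · rintro ⟨φ, rfl⟩
      exact B.mem_graph (Hbar2.emb B φ)
    · intro hz
      obtain ⟨y, hy, hy'⟩ := LinearPMap.mem_graph_iff _ |>.1 hz
      have hy1 : (y : H) = Bbar B z.snd := hy
      have hm : Bbar B z.snd ∈ B.domain := hy1 ▸ y.2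
      refine ⟨(⟨z.snd, hm⟩ : hbar2 B), ?_⟩
      have e : y = ⟨Bbar B z.snd, hm⟩ := Subtype.ext hy1
      have : B ⟨Bbar B z.snd, hm⟩ = z.fst := e ▸ hy'
      exact (WithLp.ofLp_injective 2) (Prod.ext this rfl)
  rw [hr]
  exact (IsClosed.preimage hq hB.isClosed).isComplete

theorem R0_mem (hB : IsSelfAdjoint B) {l : ℝ} (hl : l ≠ 0) (x : B.domain) :
    ∃ hv : B ⟨R0 hB hl (x : H), sq_domain_le B (R0 hB hl (x : H)).2⟩ ∈ (sq B).domain,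
      sqAdd B l ⟨B ⟨R0 hB hl (x : H), sq_domain_le B (R0 hB hl (x : H)).2⟩, hv⟩ = B x := by
  have h := sqAdd_R0 hB hl (x : H)
  set u := R0 hB hl (x : H)
  have h' : sq B u + ((l : 𝕜) ^ 2) • (u : H) = x := h
  have hs : sq B u = ((x - ((l : 𝕜) ^ 2) • (⟨u, sq_domain_le B u.2⟩ : B.domain) : B.domain) : H) :=
    eq_sub_of_add_eq h'
  have hv : B ⟨u, sq_domain_le B u.2⟩ ∈ (sq B).domain :=
    mem_sq_domain.2 ⟨(mem_sq_domain.1 u.2).2, by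
      change sq B u ∈ B.domain
      rw [hs]; exact Subtype.property _⟩
  refine ⟨hv, ?_⟩
  change B ⟨sq B u, _⟩ + ((l : 𝕜) ^ 2) • B ⟨u, sq_domain_le B u.2⟩ = B x
  have e : (⟨sq B u, hs ▸ Subtype.property _⟩ : B.domain) =
      x - ((l : 𝕜) ^ 2) • (⟨u, sq_domain_le B u.2⟩ : B.domain) := Subtype.ext hs
  rw [e, B.map_sub, B.map_smul, sub_add_cancel]

theorem R0E_bound {l : ℝ} (hl : l ≠ 0) {a b c : ℝ} (ha : 0 ≤ a) (hb : 0 ≤ b) (hc : 0 ≤ c) :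
    a + b ≤ ((l ^ 2)⁻¹ + |l|⁻¹) ^ 2 * (c + 2 * l ^ 2 * a + l ^ 4 * b) := by
  have hl' : 0 < |l| := abs_pos.2 hl
  have e2 : l ^ 2 = |l| ^ 2 := (sq_abs l).symm
  have e4 : l ^ 4 = |l| ^ 4 := by rw [show l ^ 4 = (l ^ 2) ^ 2 by ring, e2]; ring
  rw [e2, e4]
  generalize |l| = k at *
  have h1 : ((k ^ 2)⁻¹ + k⁻¹) ^ 2 * (c + 2 * k ^ 2 * a + k ^ 4 * b)
      = a + b + (((k ^ 2)⁻¹ + k⁻¹) ^ 2 * c + (2 * (k⁻¹ + 1) ^ 2 - 1) * a + (2 * k + k ^ 2) * b) := by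
    field_simp
    ring
  have h2 : 0 ≤ 2 * (k⁻¹ + 1) ^ 2 - 1 := by
    have : 0 < k⁻¹ := by positivity
    nlinarith
  rw [h1]
  have : 0 ≤ ((k ^ 2)⁻¹ + k⁻¹) ^ 2 * c + (2 * (k⁻¹ + 1) ^ 2 - 1) * a + (2 * k + k ^ 2) * b := by
    positivity
  linarith

/-- `R₀(l)` on the domain of `B`, as a bounded operator from the norm of `H̄₁` to `H̄₂`. -/
def R0E (hB : IsSelfAdjoint B) {l : ℝ} (hl : l ≠ 0) : EnergyDom B →L[𝕜] Hbar2 B :=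
  LinearMap.mkContinuous (σ := RingHom.id 𝕜)
    (show EnergyDom B →ₗ[𝕜] Hbar2 B from toHbar2 B ∘ₗ R0 hB hl ∘ₗ B.domain.subtype)
    ((l ^ 2)⁻¹ + |l|⁻¹) fun x => by
    refine le_of_sq_le_sq ?_ (by positivity)
    obtain ⟨hv, h⟩ := R0_mem hB hl x
    have hn := norm_sqAdd hB l ⟨_, hv⟩
    rw [h] at hn
    change ‖toHbar2 B (R0 hB hl (show B.domain from x).1)‖ ^ 2 ≤ _
    rw [norm_toHbar2_sq, mul_pow]
    have hx : ‖x‖ ^ 2 = _ := hn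
    rw [hx]
    exact R0E_bound hl (sq_nonneg _) (sq_nonneg _) (sq_nonneg _)

/-- `R̄₀(l) : H̄₁ → H̄₂`: the bounded extension of `R₀(l)`. -/
def R0bar (hB : IsSelfAdjoint B) {l : ℝ} (hl : l ≠ 0) : Hbar1 B →L[𝕜] Hbar2 B :=
  haveI := completeSpace_Hbar2 hB
  (R0E hB hl).extend UniformSpace.Completion.toComplL

end Resolvent

/-! ### Singular perturbations -/

section Perturbation

variable {𝕜 H h V : Type*} [RCLike 𝕜]
variable [NormedAddCommGroup H] [InnerProductSpace 𝕜 H] [CompleteSpace H]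
variable [NormedAddCommGroup h] [InnerProductSpace 𝕜 h] [CompleteSpace h]
variable [AddCommGroup V] [Module 𝕜 V]
variable {B : H →ₗ.[𝕜] H}

/-- `W(φ, ψ) = (ψ, Ā φ)` on `H̄₁ ⊕ H`, with domain `H̄₂ ⊕ H₁`. -/
def W (B : H →ₗ.[𝕜] H) : WithLp 2 (Hbar1 B × H) →ₗ.[𝕜] WithLp 2 (Hbar1 B × H) where
  domain := ((hbar2 B).prod B.domain).comap (WithLp.linearEquiv 2 𝕜 (Hbar1 B × H)).toLinearMap
  toFun :=
    { toFun := fun x => WithLp.toLp 2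
        (toHbar1 B ⟨x.1.snd, x.2.2⟩, Abar B (Hbar2.mk x.1.fst x.2.1))
      map_add' := fun x y => congrArg (WithLp.toLp 2) <| Prod.ext
        ((toHbar1 B).map_add ⟨x.1.snd, x.2.2⟩ ⟨y.1.snd, y.2.2⟩)
        ((Abar B).map_add (Hbar2.mk x.1.fst x.2.1) (Hbar2.mk y.1.fst y.2.1))
      map_smul' := fun c x => congrArg (WithLp.toLp 2) <| Prod.ext
        ((toHbar1 B).map_smul c ⟨x.1.snd, x.2.2⟩)
        ((Abar B).map_smul c (Hbar2.mk x.1.fst x.2.1)) }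

theorem eq_zero_of_inner_eq_zero {Θ : h →L[𝕜] h} (hΘ : Θ.IsPositive) {z : h}
    (hz : inner 𝕜 (Θ z) z = 0) : Θ z = 0 := by
  set w := Θ z with hw
  have hsym : inner 𝕜 (Θ w) z = inner 𝕜 w w := hΘ.isSymmetric w z
  have hc := hΘ.re_inner_nonneg_left w
  have key : ∀ t : ℝ, 0 ≤ 2 * t * ‖w‖ ^ 2 + t ^ 2 * RCLike.re (inner 𝕜 (Θ w) w) := by
    intro t
    have h1 := hΘ.re_inner_nonneg_left (z + (t : 𝕜) • w)
    have h2 : inner 𝕜 (Θ (z + (t : 𝕜) • w)) (z + (t : 𝕜) • w) =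
        ((2 * t : ℝ) : 𝕜) * inner 𝕜 w w + ((t ^ 2 : ℝ) : 𝕜) * inner 𝕜 (Θ w) w := by
      rw [map_add, map_smul, ← hw]
      simp only [inner_add_left, inner_add_right, inner_smul_left, inner_smul_right, hz, hsym,
        RCLike.conj_ofReal]
      push_cast
      ring
    rw [h2, map_add, RCLike.re_ofReal_mul, RCLike.re_ofReal_mul, inner_self_eq_norm_sq] at h1
    exact h1
  generalize RCLike.re (inner 𝕜 (Θ w) w) = c at *
  have h3 := key (-(‖w‖ ^ 2) / (c + 1))
  have h4 : 2 * (-(‖w‖ ^ 2) / (c + 1)) * ‖w‖ ^ 2 + (-(‖w‖ ^ 2) / (c + 1)) ^ 2 * c =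
      -((‖w‖ ^ 2 / (c + 1)) ^ 2 * (c + 2)) := by
    field_simp
    ring
  rw [h4] at h3
  have h5 : (‖w‖ ^ 2 / (c + 1)) ^ 2 = 0 := by
    have : 0 ≤ (‖w‖ ^ 2 / (c + 1)) ^ 2 := by positivity
    nlinarith
  have h6 : ‖w‖ ^ 2 / (c + 1) = 0 := by simpa using h5
  rw [div_eq_zero_iff] at h6
  rcases h6 with h6 | h6
  · simpa using h6
  · linarith

/-- The space `h` with the inner product `⟪Θ ζ, η⟫`. -/
def HTheta (Θ : h →L[𝕜] h) (_ : Θ.IsPositive) (_ : Function.Injective Θ) : Type _ := h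

section HTheta

variable (Θ : h →L[𝕜] h) (hΘ : Θ.IsPositive) (hΘi : Function.Injective Θ)

instance : AddCommGroup (HTheta Θ hΘ hΘi) := inferInstanceAs (AddCommGroup h)
instance : Module 𝕜 (HTheta Θ hΘ hΘi) := inferInstanceAs (Module 𝕜 h)

/-- The identity from `h_Θ` to `h`. -/
def HTheta.val : HTheta Θ hΘ hΘi ≃ₗ[𝕜] h := LinearEquiv.refl 𝕜 h

/-- The inner product `⟪Θ ζ, η⟫`. -/
@[reducible]
def HTheta.core : InnerProductSpace.Core 𝕜 (HTheta Θ hΘ hΘi) where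
  inner ζ η := inner 𝕜 (Θ (HTheta.val Θ hΘ hΘi ζ)) (HTheta.val Θ hΘ hΘi η)
  conj_inner_symm ζ η := by
    rw [inner_conj_symm]
    exact (hΘ.isSymmetric _ _).symm
  re_inner_nonneg ζ := hΘ.re_inner_nonneg_left _
  add_left ζ η ξ := by
    simp only [map_add, inner_add_left]
  smul_left ζ η c := by
    simp only [map_smul, inner_smul_left]
  definite ζ hζ := by
    have hz : inner 𝕜 (Θ (HTheta.val Θ hΘ hΘi ζ)) (HTheta.val Θ hΘ hΘi ζ) = 0 := hζ
    have hs := eq_zero_of_inner_eq_zero hΘ hz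
    exact (HTheta.val Θ hΘ hΘi).injective (hΘi (by rw [hs, map_zero, map_zero]))

instance : NormedAddCommGroup (HTheta Θ hΘ hΘi) := (HTheta.core Θ hΘ hΘi).toNormedAddCommGroup
instance : InnerProductSpace 𝕜 (HTheta Θ hΘ hΘi) :=
  InnerProductSpace.ofCore (HTheta.core Θ hΘ hΘi).toCore

end HTheta

/-- `τ_Θ(φ, ψ, ζ) = τ φ - Θ ζ`. -/
def tauTheta (τ : Hbar2 B →L[𝕜] h) (Θ : h →L[𝕜] h) : Hbar2 B × H × h →ₗ[𝕜] h :=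
  τ.toLinearMap ∘ₗ LinearMap.fst 𝕜 _ _ -
    Θ.toLinearMap ∘ₗ LinearMap.snd 𝕜 _ _ ∘ₗ LinearMap.snd 𝕜 _ _

/-- `τ* : h → H₋₂`, `τ* ζ = (φ ↦ ⟪ζ, τ φ⟫)`, where `H₋₂` is the dual of `H₂`. -/
def tauStar (hB : IsSelfAdjoint B) (τ : Hbar2 B →L[𝕜] h) (ζ : h) : StrongDual 𝕜 (H2 B) :=
  (innerSL 𝕜 ζ).comp (τ.comp (H2toHbar2 hB))

/-- `H₋₁`, the dual of `H₁`, as a subset of `H₋₂`, the dual of `H₂`. -/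
def HNegOne (hB : IsSelfAdjoint B) : Set (StrongDual 𝕜 (H2 B)) :=
  Set.range fun m : StrongDual 𝕜 (H1 B) => m.comp (H2toH1 hB)

/-- `G(l) = (τ R₀(l))*`. -/
def Gl (hB : IsSelfAdjoint B) (τ : Hbar2 B →L[𝕜] h) {l : ℝ} (hl : l ≠ 0) : h →L[𝕜] H :=
  (τ.comp ((H2toHbar2 hB).comp (R0L hB hl))).adjoint

/-- `Ḡ(l) = (τ R̄₀(l))*`. -/
def Gbar (hB : IsSelfAdjoint B) (τ : Hbar2 B →L[𝕜] h) {l : ℝ} (hl : l ≠ 0) : h →L[𝕜] Hbar1 B :=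
  (τ.comp (R0bar hB hl)).adjoint

/-- `H` and `H̄₁` are contained in the vector space `V`, by means of `i₀` and `i₁`: the two
inclusions agree on the domain of `B`, which is the intersection of `H` and `H̄₁`. -/
structure IsCommonSpace (B : H →ₗ.[𝕜] H) (i₀ : H →ₗ[𝕜] V) (i₁ : Hbar1 B →ₗ[𝕜] V) : Prop where
  inj₀ : Function.Injective i₀
  inj₁ : Function.Injective i₁
  compat : ∀ x : B.domain, i₀ x = i₁ (toHbar1 B x)
  inter : ∀ (x : H) (φ : Hbar1 B), i₀ x = i₁ φ → x ∈ B.domain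

/-- `G = G(l) + l² Ḡ(l) : h → V`. -/
def G (hB : IsSelfAdjoint B) (τ : Hbar2 B →L[𝕜] h) (i₀ : H →ₗ[𝕜] V) (i₁ : Hbar1 B →ₗ[𝕜] V)
    {l : ℝ} (hl : l ≠ 0) : h →ₗ[𝕜] V :=
  i₀ ∘ₗ (Gl hB τ hl).toLinearMap + ((l : 𝕜) ^ 2) • i₁ ∘ₗ (Gbar hB τ hl).toLinearMap

/-- The map `(φ₀, ζ) ↦ φ₀ + g ζ`. -/
def sumMap (i₁ : Hbar1 B →ₗ[𝕜] V) (g : h →ₗ[𝕜] V) : Hbar1 B × h →ₗ[𝕜] V := i₁.coprod g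

/-- `K̄₁`: the subspace of the vectors `φ₀ + g ζ` of `V`, with `φ₀` in `H̄₁` and `ζ` in `h`. -/
def Kbar1 (i₁ : Hbar1 B →ₗ[𝕜] V) (g : h →ₗ[𝕜] V) (Θ : h →L[𝕜] h) (_ : Θ.IsPositive)
    (_ : Function.Injective Θ) (_ : Function.Injective (sumMap i₁ g)) : Type _ :=
  LinearMap.range (sumMap i₁ g)

section Kbar1

variable (i₀ : H →ₗ[𝕜] V) (i₁ : Hbar1 B →ₗ[𝕜] V) (g : h →ₗ[𝕜] V) (Θ : h →L[𝕜] h)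
  (hΘ : Θ.IsPositive) (hΘi : Function.Injective Θ) (hU : Function.Injective (sumMap i₁ g))

instance : AddCommGroup (Kbar1 i₁ g Θ hΘ hΘi hU) :=
  inferInstanceAs (AddCommGroup (LinearMap.range (sumMap i₁ g)))
instance : Module 𝕜 (Kbar1 i₁ g Θ hΘ hΘi hU) :=
  inferInstanceAs (Module 𝕜 (LinearMap.range (sumMap i₁ g)))

/-- An element of `V` of the form `φ₀ + g ζ`, as an element of `K̄₁`. -/
def Kbar1.mk (φ : V) (hφ : φ ∈ LinearMap.range (sumMap i₁ g)) : Kbar1 i₁ g Θ hΘ hΘi hU :=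
  (⟨φ, hφ⟩ : LinearMap.range (sumMap i₁ g))

/-- The identification of `H̄₁ × h` with `K̄₁`. -/
def Kbar1.equiv : (Hbar1 B × h) ≃ₗ[𝕜] Kbar1 i₁ g Θ hΘ hΘi hU := LinearEquiv.ofInjective _ hU

/-- The component `φ₀` of `φ = φ₀ + g ζ`. -/
def Kbar1.reg : Kbar1 i₁ g Θ hΘ hΘi hU →ₗ[𝕜] Hbar1 B :=
  LinearMap.fst 𝕜 _ _ ∘ₗ (Kbar1.equiv i₁ g Θ hΘ hΘi hU).symm.toLinearMap

/-- The component `ζ` of `φ = φ₀ + g ζ`. -/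
def Kbar1.charge : Kbar1 i₁ g Θ hΘ hΘi hU →ₗ[𝕜] h :=
  LinearMap.snd 𝕜 _ _ ∘ₗ (Kbar1.equiv i₁ g Θ hΘ hΘi hU).symm.toLinearMap

/-- `φ₀ + g ζ ↦ (φ₀, ζ)`, with values in `H̄₁ ⊕ h_Θ`. -/
def Kbar1.emb : Kbar1 i₁ g Θ hΘ hΘi hU →ₗ[𝕜] WithLp 2 (Hbar1 B × HTheta Θ hΘ hΘi) :=
  (WithLp.linearEquiv 2 𝕜 (Hbar1 B × HTheta Θ hΘ hΘi)).symm.toLinearMap ∘ₗ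
    (Kbar1.equiv i₁ g Θ hΘ hΘi hU).symm.toLinearMap

/-- The norm of the inner product `⟪B̄ φ₀, B̄ φ₀'⟫ + ⟪Θ ζ, ζ'⟫`. -/
instance : NormedAddCommGroup (Kbar1 i₁ g Θ hΘ hΘi hU) :=
  NormedAddCommGroup.induced _ _ (Kbar1.emb i₁ g Θ hΘ hΘi hU) <|
    (WithLp.linearEquiv 2 𝕜 (Hbar1 B × HTheta Θ hΘ hΘi)).symm.injective.comp
      (Kbar1.equiv i₁ g Θ hΘ hΘi hU).symm.injective
instance : InnerProductSpace 𝕜 (Kbar1 i₁ g Θ hΘ hΘi hU) :=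
  InnerProductSpace.induced (Kbar1.emb i₁ g Θ hΘ hΘi hU)

/-- `K̄₁ ⊕ H`. -/
abbrev KTot : Type _ := WithLp 2 (Kbar1 i₁ g Θ hΘ hΘi hU × H)

/-- `H̄₁ ⊕ H ⊕ h_Θ`. -/
abbrev HTot (B : H →ₗ.[𝕜] H) (Θ : h →L[𝕜] h) (hΘ : Θ.IsPositive) (hΘi : Function.Injective Θ) :
    Type _ := WithLp 2 (Hbar1 B × WithLp 2 (H × HTheta Θ hΘ hΘi))

/-- The inclusion of `H̄₁ ⊕ H` in `K̄₁ ⊕ H`. -/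
def incl : WithLp 2 (Hbar1 B × H) →ₗ[𝕜] KTot i₁ g Θ hΘ hΘi hU :=
  (WithLp.linearEquiv 2 𝕜 (Kbar1 i₁ g Θ hΘ hΘi hU × H)).symm.toLinearMap ∘ₗ
    (((Kbar1.equiv i₁ g Θ hΘ hΘi hU).toLinearMap ∘ₗ LinearMap.inl 𝕜 (Hbar1 B) h).prodMap
      LinearMap.id) ∘ₗ (WithLp.linearEquiv 2 𝕜 (Hbar1 B × H)).toLinearMap

/-- The vectors `(φ, ψ)` of `K̄₂ ⊕ K₁` with `Θ ζ = τ φ₀`, where `φ = φ₀ + g ζ`. Here `φ` is in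
`K̄₂` if `φ₀` is in `H̄₂`, and `K₁` is the intersection of `K̄₁` and `H` in `V`. -/
def WThetaDomain (τ : Hbar2 B →L[𝕜] h) : Submodule 𝕜 (KTot i₁ g Θ hΘ hΘi hU) where
  carrier := {x | (∃ φ₀ : Hbar2 B, Hbar2.incl B φ₀ = Kbar1.reg i₁ g Θ hΘ hΘi hU x.fst ∧
      Θ (Kbar1.charge i₁ g Θ hΘ hΘi hU x.fst) = τ φ₀) ∧
    i₀ x.snd ∈ LinearMap.range (sumMap i₁ g)}
  zero_mem' := ⟨⟨0, by simp⟩, by simp⟩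
  add_mem' := by
    rintro x y ⟨⟨φ, h1, h2⟩, h3⟩ ⟨⟨φ', h1', h2'⟩, h3'⟩
    exact ⟨⟨φ + φ', by simp [h1, h1'], by simp [h2, h2']⟩, by
      rw [WithLp.add_snd, map_add]; exact add_mem h3 h3'⟩
  smul_mem' := by
    rintro c x ⟨⟨φ, h1, h2⟩, h3⟩
    exact ⟨⟨c • φ, by simp [h1], by simp [h2]⟩, by
      rw [WithLp.smul_snd, map_smul]; exact Submodule.smul_mem _ c h3⟩

theorem mem_hbar2_of_mem {τ : Hbar2 B →L[𝕜] h} {x : KTot i₁ g Θ hΘ hΘi hU}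
    (hx : x ∈ WThetaDomain i₀ i₁ g Θ hΘ hΘi hU τ) :
    Kbar1.reg i₁ g Θ hΘ hΘi hU x.fst ∈ hbar2 B := by
  obtain ⟨⟨φ, h1, -⟩, -⟩ := hx
  exact h1 ▸ φ.2

/-- `W_Θ(φ, ψ) = (ψ, Ā φ₀)`. -/
def WTheta (τ : Hbar2 B →L[𝕜] h) :
    KTot i₁ g Θ hΘ hΘi hU →ₗ.[𝕜] KTot i₁ g Θ hΘ hΘi hU where
  domain := WThetaDomain i₀ i₁ g Θ hΘ hΘi hU τ
  toFun :=
    { toFun := fun x => WithLp.toLp 2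
        (Kbar1.mk i₁ g Θ hΘ hΘi hU (i₀ x.1.snd) x.2.2,
          Abar B (Hbar2.mk (Kbar1.reg i₁ g Θ hΘ hΘi hU x.1.fst)
            (mem_hbar2_of_mem i₀ i₁ g Θ hΘ hΘi hU x.2)))
      map_add' := fun x y => congrArg (WithLp.toLp 2) <| Prod.ext
        (Subtype.ext (i₀.map_add x.1.snd y.1.snd))
        ((congrArg (Abar B) <| Subtype.ext <|
          (Kbar1.reg i₁ g Θ hΘ hΘi hU).map_add x.1.fst y.1.fst).trans ((Abar B).map_add
            (Hbar2.mk _ (mem_hbar2_of_mem i₀ i₁ g Θ hΘ hΘi hU x.2))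
            (Hbar2.mk _ (mem_hbar2_of_mem i₀ i₁ g Θ hΘ hΘi hU y.2))))
      map_smul' := fun c x => congrArg (WithLp.toLp 2) <| Prod.ext
        (Subtype.ext (i₀.map_smul c x.1.snd))
        ((congrArg (Abar B) <| Subtype.ext <|
          (Kbar1.reg i₁ g Θ hΘ hΘi hU).map_smul c x.1.fst).trans ((Abar B).map_smul c
            (Hbar2.mk _ (mem_hbar2_of_mem i₀ i₁ g Θ hΘ hΘi hU x.2)))) }

end Kbar1

/-- The graph of `W̃_Θ` on `H̄₁ ⊕ H ⊕ h_Θ`: the pairs `((φ₀, ψ, ζ), (ψ₀, Ā φ₀, ξ))` with `φ₀` in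
`H̄₂`, `Θ ζ = τ φ₀`, `ψ = ψ' + G(l) ξ` with `ψ'` in `H₁`, and `ψ₀ = ψ' - l² Ḡ(l) ξ`. -/
def WTildeGraph (hB : IsSelfAdjoint B) (τ : Hbar2 B →L[𝕜] h) (Θ : h →L[𝕜] h) (hΘ : Θ.IsPositive)
    (hΘi : Function.Injective Θ) {l : ℝ} (hl : l ≠ 0) :
    Submodule 𝕜 (HTot B Θ hΘ hΘi × HTot B Θ hΘ hΘi) where
  carrier := {p | ∃ (φ₀ : Hbar2 B) (ψ' : B.domain) (ζ ξ : h), Θ ζ = τ φ₀ ∧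
    p.1 = WithLp.toLp 2 (Hbar2.incl B φ₀, WithLp.toLp 2 ((ψ' : H) + Gl hB τ hl ξ,
      (HTheta.val Θ hΘ hΘi).symm ζ)) ∧
    p.2 = WithLp.toLp 2 (toHbar1 B ψ' - ((l : 𝕜) ^ 2) • Gbar hB τ hl ξ,
      WithLp.toLp 2 (Abar B φ₀, (HTheta.val Θ hΘ hΘi).symm ξ))}
  zero_mem' := ⟨0, 0, 0, 0, by simp, by simp; rfl, by simp; rfl⟩
  add_mem' := by
    rintro p q ⟨φ, ψ, ζ, ξ, h1, h2, h3⟩ ⟨φ', ψ', ζ', ξ', h1', h2', h3'⟩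
    refine ⟨φ + φ', ψ + ψ', ζ + ζ', ξ + ξ', by simp [h1, h1'], ?_, ?_⟩
    · rw [Prod.fst_add, h2, h2', ← WithLp.toLp_add, Prod.mk_add_mk, ← WithLp.toLp_add,
        Prod.mk_add_mk]
      simp only [map_add, Submodule.coe_add]
      congr 4
      abel
    · rw [Prod.snd_add, h3, h3', ← WithLp.toLp_add, Prod.mk_add_mk, ← WithLp.toLp_add,
        Prod.mk_add_mk]
      simp only [map_add, smul_add]
      congr 2
      abel
  smul_mem' := by
    rintro c p ⟨φ, ψ, ζ, ξ, h1, h2, h3⟩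
    refine ⟨c • φ, c • ψ, c • ζ, c • ξ, by simp [h1], ?_, ?_⟩
    · rw [Prod.smul_fst, h2, ← WithLp.toLp_smul, Prod.smul_mk, ← WithLp.toLp_smul, Prod.smul_mk]
      simp only [map_smul, Submodule.coe_smul, smul_add]
    · rw [Prod.smul_snd, h3, ← WithLp.toLp_smul, Prod.smul_mk, ← WithLp.toLp_smul, Prod.smul_mk]
      simp only [map_smul, smul_sub, smul_comm c]

/-- `W̃_Θ`. -/
def WTilde (hB : IsSelfAdjoint B) (τ : Hbar2 B →L[𝕜] h) (Θ : h →L[𝕜] h) (hΘ : Θ.IsPositive)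
    (hΘi : Function.Injective Θ) {l : ℝ} (hl : l ≠ 0) :
    HTot B Θ hΘ hΘi →ₗ.[𝕜] HTot B Θ hΘ hΘi :=
  (WTildeGraph hB τ Θ hΘ hΘi hl).toLinearPMap

end Perturbation

end AbstractWave

end

/-! Everything rests on one Green-type formula, `inner_tau`: `⟪ζ, τ φ⟫ = -⟪G(l) ζ, Ā φ⟫ + l² ⟪Ḡ(l)
ζ, φ⟫` for `φ` in `H̄₂`. It expresses `τ*` by the two maps whose sum is `G`. Comparing it at two
parameters shows that `G` does not depend on `l` (`exists_Gl_sub`, `G_eq_G`). Combined with the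
boundary condition `Θ ζ = τ φ₀` it makes `W_Θ` skew-symmetric: the term `⟪Θ ξ, ζ⟫` of the new inner
product compensates the contribution of `G ξ`.

Assumption (H3.1) enters through `eq_zero_of_tauStar`: if `τ* κ` is bounded for the norm of `H̄₁`,
then `κ = 0`. This gives uniqueness of `φ₀ + G ζ`, single-valuedness of `W̃_Θ` and both density
statements.

A densely defined skew-symmetric operator `T` with `1 - T` and `1 + T` onto is skew-adjoint, even on
an incomplete space. To solve `(m - W_Θ) x = y`, correct a solution of the unperturbed equation by
terms in a charge `ξ`; the boundary condition becomes `(Θ + m² τ Ḡ(m)) ξ = y'`. This operator is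
symmetric with form `⟪Θ ξ, ξ⟫ + m² (‖G(m) ξ‖² + m² ‖Ḡ(m) ξ‖²)`. By (H3.0) and the open mapping
theorem the form is coercive, so Lax–Milgram applies (`exists_charge`).

Density of `D(W_Θ)`: a functional vanishing there induces one on `H̄₂ × h` that factors through the
surjection `τ φ - Θ ζ`, hence is given by some `κ` in `h`. Then `τ* κ` is bounded on `H̄₁`, so `κ =
0`. -/

set_option linter.unusedSectionVars false

open scoped InnerProductSpace

noncomputable section

namespace AbstractWave

/-! ### Density and factorization through bounded functionals -/

section Functionals

variable {𝕜 E X Y : Type*} [RCLike 𝕜] [NormedAddCommGroup E] [NormedSpace 𝕜 E]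
variable [NormedAddCommGroup X] [NormedSpace 𝕜 X]
variable [NormedAddCommGroup Y] [NormedSpace 𝕜 Y]

/-- A subspace is dense if every continuous linear functional vanishing on it is zero. -/
theorem dense_of_forall_dual_eq_zero (p : Submodule 𝕜 E)
    (hp : ∀ f : StrongDual 𝕜 E, (∀ x ∈ p, f x = 0) → f = 0) : Dense (p : Set E) := by
  rw [Submodule.dense_iff_topologicalClosure_eq_top, eq_top_iff]
  intro x _
  have : IsClosed (p.topologicalClosure : Set E) := p.isClosed_topologicalClosure
  by_contra hx
  have hne : (p.topologicalClosure.mkQ x) ≠ 0 := by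
    simpa [Submodule.Quotient.mk_eq_zero] using hx
  -- Hahn–Banach in the quotient by the closure. Orthogonal complements would need `E` complete,
  -- which `K̄₁ ⊕ H` may fail to be.
  obtain ⟨g, -, hg⟩ := exists_dual_vector 𝕜 (p.topologicalClosure.mkQ x) (norm_ne_zero_iff.2 hne)
  have h0 := hp (g.comp p.topologicalClosure.mkQL) fun y hy => by
    have : p.topologicalClosure.mkQ y = 0 := by
      simpa [Submodule.Quotient.mk_eq_zero] using p.le_topologicalClosure hy
    change g (p.topologicalClosure.mkQ y) = 0
    rw [this, map_zero]
  have h1 : g (p.topologicalClosure.mkQ x) = 0 := congrArg (fun f : StrongDual 𝕜 E => f x) h0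
  rw [hg] at h1
  exact hne (norm_eq_zero.1 (by exact_mod_cast h1))

/-- A continuous functional vanishing on the kernel of a bounded operator from a Banach space onto
a Banach space factors through it. -/
theorem exists_dual_comp_of_ker [CompleteSpace X] [CompleteSpace Y] (S : X →L[𝕜] Y)
    (hS : Function.Surjective S) (F : StrongDual 𝕜 X) (hF : ∀ x, S x = 0 → F x = 0) :
    ∃ g : StrongDual 𝕜 Y, ∀ x, F x = g (S x) := by
  -- The section `r` is merely linear. Still `F ∘ r ∘ S = F` is continuous, and `S` is a quotient
  -- map by the open mapping theorem, so `F ∘ r` is continuous.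
  obtain ⟨r, hr⟩ := S.toLinearMap.exists_rightInverse_of_surjective (LinearMap.range_eq_top.2 hS)
  have hr' : ∀ y, S (r y) = y := fun y => LinearMap.congr_fun hr y
  have key : ∀ x, F (r (S x)) = F x := fun x => by
    rw [← sub_eq_zero, ← map_sub]
    exact hF _ (by rw [map_sub, hr', sub_self])
  have hc : Continuous (F.toLinearMap ∘ₗ r) := by
    rw [((S.isOpenMap hS).isQuotientMap S.continuous hS).continuous_iff]
    exact F.continuous.congr fun x => (key x).symm
  exact ⟨⟨F.toLinearMap ∘ₗ r, hc⟩, fun x => (key x).symm⟩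

end Functionals

/-! ### Skew-adjointness criterion and positive operators -/

section Skew

variable {𝕜 E : Type*} [RCLike 𝕜] [NormedAddCommGroup E] [InnerProductSpace 𝕜 E]

/-- A densely defined skew-symmetric operator `T` such that `1 - T` and `1 + T` are onto is
skew-adjoint. -/
theorem isSkewAdjoint_of_surjective (T : E →ₗ.[𝕜] E) (hd : Dense (T.domain : Set E))
    (hs : ∀ x y : T.domain, inner 𝕜 (T x) (y : E) = -inner 𝕜 (x : E) (T y))
    (h₁ : ∀ y : E, ∃ x : T.domain, (x : E) - T x = y)
    (h₂ : ∀ y : E, ∃ x : T.domain, (x : E) + T x = y) : IsSkewAdjoint T := by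
  refine ⟨hd, ?_⟩
  ext ⟨x, y⟩
  rw [Submodule.mem_adjoint_iff, LinearPMap.mem_graph_iff]
  constructor
  · intro h
    -- If `y = -T x`, then `x - T x = x + y`; so `w` is the candidate for `x`. The difference `x -
    -- w` is orthogonal to the range of `1 + T`, which is everything.
    obtain ⟨w, hw⟩ := h₁ (x + y)
    have h0 : x - w = 0 := by
      obtain ⟨z, hz⟩ := h₂ (x - w)
      rw [← inner_self_eq_zero (𝕜 := 𝕜)]
      nth_rewrite 1 [← hz]
      have e1 := h z (T z) (T.mem_graph z)
      have e2 := hs z w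
      have e3 : y = w - T w - x := by rw [hw]; abel
      simp only [e3, inner_sub_right] at e1
      simp only [inner_add_left, inner_sub_right]
      linear_combination e1 - e2
    have hx : x = w := sub_eq_zero.1 h0
    refine ⟨w, hx.symm, ?_⟩
    rw [LinearPMap.neg_apply]
    rw [hx] at hw
    exact (add_left_cancel (a := (w : E)) (by rw [← hw]; abel))
  · rintro ⟨w, hw, hw'⟩ a b hab
    obtain ⟨z, hz, hz'⟩ := (LinearPMap.mem_graph_iff _).1 hab
    simp only at hw hw' hz hz'
    rw [← hw, ← hw', ← hz, ← hz', LinearPMap.neg_apply, inner_neg_right, hs z w]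
    ring

/-- The form of `Θ` is nonnegative at `y - t Θ y`; the choice `t = ‖Θ‖⁻¹` gives the bound. It allows
`‖Θ y‖` to be controlled by the form in the coercivity estimate. -/
theorem norm_sq_le_mul_re_inner {Θ : E →L[𝕜] E} (hΘ : Θ.IsPositive) (y : E) :
    ‖Θ y‖ ^ 2 ≤ ‖Θ‖ * RCLike.re (inner 𝕜 (Θ y) y) := by
  have h1 := hΘ.re_inner_nonneg_left y
  have h2 : RCLike.re (inner 𝕜 (Θ (Θ y)) (Θ y)) ≤ ‖Θ‖ * ‖Θ y‖ ^ 2 := by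
    refine (re_inner_le_norm _ _).trans ?_
    nlinarith [Θ.le_opNorm (Θ y), norm_nonneg (Θ y)]
  have key : ∀ t : ℝ, 0 ≤ RCLike.re (inner 𝕜 (Θ y) y) - 2 * t * ‖Θ y‖ ^ 2
      + t ^ 2 * (‖Θ‖ * ‖Θ y‖ ^ 2) := by
    intro t
    have h3 := hΘ.re_inner_nonneg_left (y - (t : 𝕜) • Θ y)
    have h4 : inner 𝕜 (Θ (y - (t : 𝕜) • Θ y)) (y - (t : 𝕜) • Θ y) =
        inner 𝕜 (Θ y) y - ((2 * t : ℝ) : 𝕜) * inner 𝕜 (Θ y) (Θ y)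
          + ((t ^ 2 : ℝ) : 𝕜) * inner 𝕜 (Θ (Θ y)) (Θ y) := by
      have hsym : inner 𝕜 (Θ (Θ y)) y = inner 𝕜 (Θ y) (Θ y) := hΘ.isSymmetric (Θ y) y
      rw [map_sub, map_smul]
      simp only [inner_sub_left, inner_sub_right, inner_smul_left, inner_smul_right, hsym,
        RCLike.conj_ofReal]
      push_cast
      ring
    rw [h4, map_add, map_sub, RCLike.re_ofReal_mul, RCLike.re_ofReal_mul,
      inner_self_eq_norm_sq] at h3
    nlinarith [sq_nonneg t]
  rcases eq_or_lt_of_le (norm_nonneg Θ) with h0 | h0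
  · have : Θ = 0 := norm_eq_zero.1 h0.symm
    simp [this]
  · have h5 := key ‖Θ‖⁻¹
    have h6 : RCLike.re (inner 𝕜 (Θ y) y) - 2 * ‖Θ‖⁻¹ * ‖Θ y‖ ^ 2
      + ‖Θ‖⁻¹ ^ 2 * (‖Θ‖ * ‖Θ y‖ ^ 2) = RCLike.re (inner 𝕜 (Θ y) y) - ‖Θ‖⁻¹ * ‖Θ y‖ ^ 2 := by
      field_simp
      ring
    rw [h6, sub_nonneg, inv_mul_eq_div, div_le_iff₀ h0] at h5
    linarith

end Skew

/-! ### `B̄` as an isometry of `H̄₁` onto `H` -/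

section Energy

variable {𝕜 H : Type*} [RCLike 𝕜] [NormedAddCommGroup H] [InnerProductSpace 𝕜 H] [CompleteSpace H]
variable {B : H →ₗ.[𝕜] H}

theorem inner_Hbar1 (φ ψ : Hbar1 B) : inner 𝕜 φ ψ = inner 𝕜 (Bbar B φ) (Bbar B ψ) :=
  ((LinearIsometry.mk (Bbar B).toLinearMap (norm_Bbar B)).inner_map_map φ ψ).symm

theorem Bbar_injective (B : H →ₗ.[𝕜] H) : Function.Injective (Bbar B) := by
  rw [injective_iff_map_eq_zero]
  intro φ h
  rw [← norm_eq_zero, ← norm_Bbar, h, norm_zero]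

/-- The range is closed, since `B̄` is an isometry on a complete space, and its orthogonal
complement lies in the kernel of `B* = B`, which is zero. -/
theorem Bbar_surjective (hB : IsSelfAdjoint B) (hBi : ∀ x : B.domain, B x = 0 → x = 0) :
    Function.Surjective (Bbar B) := by
  have hiso : Isometry (Bbar B) := AddMonoidHomClass.isometry_of_norm _ (norm_Bbar B)
  have hcl : IsClosed ((Bbar B).range : Set H) := hiso.isClosedEmbedding.isClosed_range
  have : CompleteSpace (Bbar B).range := hcl.completeSpace_coe
  refine LinearMap.range_eq_top (f := (Bbar B).toLinearMap) |>.1 ?_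
  rw [← Submodule.orthogonal_eq_bot_iff, Submodule.eq_bot_iff]
  intro y hy
  obtain ⟨hy', h0⟩ := mem_of_sa hB y 0 fun x => by
    rw [inner_zero_left, ← Bbar_coe]
    exact (Submodule.inner_left_of_mem_orthogonal (LinearMap.mem_range_self _ _) hy).symm
  exact congrArg Subtype.val (hBi _ h0)

theorem dense_hbar2 (hB : IsSelfAdjoint B) (hBi : ∀ x : B.domain, B x = 0 → x = 0) :
    Dense (hbar2 B : Set (Hbar1 B)) := by
  have hopen : IsOpenMap (Bbar B) := (Bbar B).isOpenMap (Bbar_surjective hB hBi)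
  exact hB.dense_domain.preimage hopen

theorem norm_Hbar2_sq (φ : Hbar2 B) :
    ‖φ‖ ^ 2 = ‖Abar B φ‖ ^ 2 + ‖Hbar2.incl B φ‖ ^ 2 := by
  have h1 : ‖φ‖ ^ 2 = _ := norm_H1_sq (Hbar2.emb B φ)
  have h2 : Abar B φ = -B (Hbar2.emb B φ) := rfl
  have h3 : ‖Bbar B (Hbar2.incl B φ)‖ = _ := norm_Bbar B (Hbar2.incl B φ)
  rw [h1, h2, norm_neg, ← h3]
  rfl

theorem norm_Abar_le (φ : Hbar2 B) : ‖Abar B φ‖ ≤ ‖φ‖ :=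
  le_of_sq_le_sq (by rw [norm_Hbar2_sq]; nlinarith [sq_nonneg ‖Hbar2.incl B φ‖]) (norm_nonneg _)

theorem norm_incl_le (φ : Hbar2 B) : ‖Hbar2.incl B φ‖ ≤ ‖φ‖ :=
  le_of_sq_le_sq (by rw [norm_Hbar2_sq]; nlinarith [sq_nonneg ‖Abar B φ‖]) (norm_nonneg _)

/-- The inclusion of `H̄₂` in `H̄₁` as a bounded operator. -/
def inclL (B : H →ₗ.[𝕜] H) : Hbar2 B →L[𝕜] Hbar1 B :=
  (Hbar2.incl B).mkContinuous 1 fun φ => by rw [one_mul]; exact norm_incl_le φ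

/-- Symmetry of `B`, in the form in which it cancels the off-diagonal terms of `W` and `W_Θ`. -/
theorem inner_toHbar1 (hB : IsSelfAdjoint B) (x : B.domain) (φ : Hbar2 B) :
    inner 𝕜 (toHbar1 B x) (Hbar2.incl B φ) = -inner 𝕜 (x : H) (Abar B φ) := by
  rw [inner_Hbar1, Bbar_coe]
  have h2 : Abar B φ = -B (Hbar2.emb B φ) := rfl
  rw [h2, inner_neg_right, neg_neg]
  exact symm_of_sa hB x (Hbar2.emb B φ)

/-- The canonical map from `H₁` to `H̄₁` as a bounded operator. -/
def toHbar1L (B : H →ₗ.[𝕜] H) : H1 B →L[𝕜] Hbar1 B :=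
  LinearMap.mkContinuous (σ := RingHom.id 𝕜) (show H1 B →ₗ[𝕜] Hbar1 B from toHbar1 B) 1 fun x => by
    rw [one_mul]
    refine le_of_sq_le_sq ?_ (norm_nonneg _)
    rw [norm_H1_sq]
    have h : ‖toHbar1 B x‖ = ‖B (x : B.domain)‖ :=
      (norm_Bbar B _).symm.trans (congrArg norm (Bbar_coe B x))
    change ‖toHbar1 B x‖ ^ 2 ≤ _
    rw [h]
    nlinarith [sq_nonneg ‖(x : B.domain).1‖]

end Energy

/-! ### Resolvent identities and skew-adjointness of `W` -/

section ResolventIdentities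

variable {𝕜 H : Type*} [RCLike 𝕜] [NormedAddCommGroup H] [InnerProductSpace 𝕜 H] [CompleteSpace H]
variable {B : H →ₗ.[𝕜] H}

theorem R0_sqAdd (hB : IsSelfAdjoint B) {l : ℝ} (hl : l ≠ 0) (u : (sq B).domain) :
    R0 hB hl (sqAdd B l u) = u :=
  sqAdd_injective hB hl (sqAdd_R0 hB hl _)

theorem norm_R0_le (hB : IsSelfAdjoint B) {l : ℝ} (hl : l ≠ 0) (f : H) :
    ‖(R0 hB hl f : H)‖ ≤ (l ^ 2)⁻¹ * ‖f‖ := by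
  have h := norm_sqAdd hB l (R0 hB hl f)
  rw [sqAdd_R0] at h
  have hl2 : 0 < l ^ 2 := by positivity
  rw [inv_mul_eq_div, le_div_iff₀ hl2]
  refine le_of_sq_le_sq ?_ (norm_nonneg _)
  rw [h]
  have a2 : 0 ≤ 2 * l ^ 2 * ‖B ⟨R0 hB hl f, sq_domain_le B (R0 hB hl f).2⟩‖ ^ 2 := by positivity
  nlinarith [sq_nonneg ‖sq B (R0 hB hl f)‖]

theorem continuous_R0 (hB : IsSelfAdjoint B) {l : ℝ} (hl : l ≠ 0) :
    Continuous fun f => (R0 hB hl f : H) :=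
  AddMonoidHomClass.continuous_of_bound ((sq B).domain.subtype ∘ₗ R0 hB hl) _ (norm_R0_le hB hl)

theorem R0_comm (hB : IsSelfAdjoint B) {l : ℝ} (hl : l ≠ 0) (x : B.domain) :
    (R0 hB hl (B x) : H) = B ⟨R0 hB hl (x : H), sq_domain_le B (R0 hB hl (x : H)).2⟩ := by
  obtain ⟨hv, h⟩ := R0_mem hB hl x
  rw [← h, R0_sqAdd]

theorem R0bar_coe (hB : IsSelfAdjoint B) {l : ℝ} (hl : l ≠ 0) (x : B.domain) :
    R0bar hB hl (toHbar1 B x) = toHbar2 B (R0 hB hl (x : H)) :=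
  haveI := completeSpace_Hbar2 hB
  ContinuousLinearMap.extend_eq _ UniformSpace.Completion.denseRange_coe
    (UniformSpace.Completion.isUniformInducing_coe (EnergyDom B)) _

theorem incl_toHbar2 (u : (sq B).domain) :
    Hbar2.incl B (toHbar2 B u) = toHbar1 B ⟨u, sq_domain_le B u.2⟩ := rfl

/-- On `D(B)` this is the commutation of `B` with its resolvent; both sides are continuous on the
completion. It transports questions about `R̄₀(l)` to `H`. -/
theorem Bbar_R0bar (hB : IsSelfAdjoint B) {l : ℝ} (hl : l ≠ 0) (φ : Hbar1 B) :
    Bbar B (Hbar2.incl B (R0bar hB hl φ)) = R0 hB hl (Bbar B φ) := by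
  induction φ using UniformSpace.Completion.induction_on with
  | hp =>
    exact isClosed_eq ((Bbar B).continuous.comp ((inclL B).continuous.comp
      (R0bar hB hl).continuous)) ((continuous_R0 hB hl).comp (Bbar B).continuous)
  | ih x =>
    have h : ∀ x : B.domain, Bbar B (Hbar2.incl B (R0bar hB hl (toHbar1 B x))) =
        R0 hB hl (Bbar B (toHbar1 B x)) := fun x => by
      rw [R0bar_coe, incl_toHbar2, Bbar_coe, Bbar_coe, R0_comm]
    exact h x

theorem sq_R0_add (hB : IsSelfAdjoint B) {l : ℝ} (hl : l ≠ 0) (f : H) :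
    B ⟨B ⟨R0 hB hl f, sq_domain_le B (R0 hB hl f).2⟩, (mem_sq_domain.1 (R0 hB hl f).2).2⟩
      + ((l : 𝕜) ^ 2) • (R0 hB hl f : H) = f :=
  sqAdd_R0 hB hl f

theorem Hbar2_ext {φ ψ : Hbar2 B} (h : Bbar B (Hbar2.incl B φ) = Bbar B (Hbar2.incl B ψ)) :
    φ = ψ :=
  Subtype.ext (Bbar_injective B h)

theorem Abar_eq (φ : Hbar2 B) : Abar B φ = -B ⟨Bbar B (Hbar2.incl B φ), φ.2⟩ := rfl

/-- Every `φ` in `H̄₂` is `R₀(l)(- Ā φ) + l² R̄₀(l) φ`. -/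
theorem toHbar2_R0_add_R0bar (hB : IsSelfAdjoint B) {l : ℝ} (hl : l ≠ 0) (φ : Hbar2 B) :
    toHbar2 B (R0 hB hl (-Abar B φ)) + ((l : 𝕜) ^ 2) • R0bar hB hl (Hbar2.incl B φ) = φ := by
  -- After applying the injective `B̄`, the claim is `(B² + l²) R₀(l) f = f` for `f = B̄ φ`.
  apply Hbar2_ext
  rw [map_add, map_add, map_smul, map_smul, Bbar_R0bar, incl_toHbar2, Bbar_coe, Abar_eq, neg_neg]
  have h := sq_R0_add hB hl (Bbar B (Hbar2.incl B φ))
  conv_rhs => rw [← h]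
  congr 2
  exact Subtype.ext (R0_comm hB hl ⟨Bbar B (Hbar2.incl B φ), φ.2⟩)

/-- `m - W` is onto. -/
theorem exists_resolvent_W (hB : IsSelfAdjoint B) (hBi : ∀ x : B.domain, B x = 0 → x = 0)
    {m : ℝ} (hm : m ≠ 0) (a : Hbar1 B) (c : H) :
    ∃ (χ : Hbar2 B) (ψ : B.domain), (m : 𝕜) • Hbar2.incl B χ - toHbar1 B ψ = a ∧
      (m : 𝕜) • (ψ : H) - Abar B χ = c := by
  -- With `u = B̄ χ` the system reads `m u - B ψ = b`, `m ψ + B u = c`. For `R = R₀(m)` its solution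
  -- is `u = m R b + B R c`, `ψ = m R c - B R b`.
  let b := Bbar B a
  let ra : B.domain := ⟨R0 hB hm b, sq_domain_le B (R0 hB hm b).2⟩
  let rc : B.domain := ⟨R0 hB hm c, sq_domain_le B (R0 hB hm c).2⟩
  let sa : B.domain := ⟨B ra, (mem_sq_domain.1 (R0 hB hm b).2).2⟩
  let sc : B.domain := ⟨B rc, (mem_sq_domain.1 (R0 hB hm c).2).2⟩
  have ha : B sa + ((m : 𝕜) ^ 2) • (ra : H) = b := sq_R0_add hB hm b
  have hc : B sc + ((m : 𝕜) ^ 2) • (rc : H) = c := sq_R0_add hB hm c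
  let u : B.domain := (m : 𝕜) • ra + sc
  obtain ⟨χ, hχ⟩ := Bbar_surjective hB hBi (u : H)
  have hχ2 : χ ∈ hbar2 B := by change Bbar B χ ∈ B.domain; rw [hχ]; exact u.2
  refine ⟨Hbar2.mk χ hχ2, (m : 𝕜) • rc - sa, ?_, ?_⟩
  · apply Bbar_injective B
    rw [map_sub, map_smul, Bbar_coe]
    change (m : 𝕜) • Bbar B χ - _ = b
    rw [hχ, B.map_sub, B.map_smul, ← ha]
    change (m : 𝕜) • ((m : 𝕜) • (ra : H) + B rc) - _ = _
    rw [smul_add, smul_smul, pow_two]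
    abel
  · have h : Abar B (Hbar2.mk χ hχ2) = -B u := by
      rw [Abar_eq]
      congr 2
      exact Subtype.ext hχ
    rw [h, B.map_add, B.map_smul, ← hc]
    change (m : 𝕜) • ((m : 𝕜) • (rc : H) - B ra) - _ = _
    rw [smul_sub, smul_smul, pow_two]
    abel

theorem W_apply (x : (W B).domain) : W B x = WithLp.toLp 2
    (toHbar1 B ⟨x.1.snd, x.2.2⟩, Abar B (Hbar2.mk x.1.fst x.2.1)) := rfl

theorem dense_prod_toLp {𝕜 E F : Type*} [RCLike 𝕜] [NormedAddCommGroup E] [InnerProductSpace 𝕜 E]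
    [NormedAddCommGroup F] [InnerProductSpace 𝕜 F] {s : Set E} {t : Set F} (hs : Dense s)
    (ht : Dense t) : Dense {x : WithLp 2 (E × F) | x.fst ∈ s ∧ x.snd ∈ t} :=
  (hs.prod ht).preimage (WithLp.homeomorphProd 2 E F).isOpenMap

theorem surjective_sub_W (hB : IsSelfAdjoint B) (hBi : ∀ x : B.domain, B x = 0 → x = 0)
    {m : ℝ} (hm : m ≠ 0) (y : WithLp 2 (Hbar1 B × H)) :
    ∃ x : (W B).domain, (m : 𝕜) • (x : WithLp 2 (Hbar1 B × H)) - W B x = y := by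
  obtain ⟨χ, ψ, h1, h2⟩ := exists_resolvent_W hB hBi hm y.fst y.snd
  exact ⟨⟨WithLp.toLp 2 (Hbar2.incl B χ, (ψ : H)), χ.2, ψ.2⟩,
    WithLp.ofLp_injective 2 (Prod.ext h1 h2)⟩

theorem isSkewAdjoint_W (hB : IsSelfAdjoint B) (hBi : ∀ x : B.domain, B x = 0 → x = 0) :
    IsSkewAdjoint (W B) := by
  have hk : ∀ x y : (W B).domain, inner 𝕜 (W B x) (y : WithLp 2 (Hbar1 B × H)) =
      -inner 𝕜 (x.1.snd) (Abar B (Hbar2.mk y.1.fst y.2.1))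
        + inner 𝕜 (Abar B (Hbar2.mk x.1.fst x.2.1)) y.1.snd := by
    intro x y
    rw [W_apply, WithLp.prod_inner_apply]
    exact congrArg (· + _)
      (inner_toHbar1 hB ⟨x.1.snd, x.2.2⟩ (Hbar2.mk y.1.fst y.2.1))
  refine isSkewAdjoint_of_surjective _ (dense_prod_toLp (𝕜 := 𝕜) (dense_hbar2 hB hBi)
    hB.dense_domain) ?_ ?_ ?_
  · intro x y
    rw [← inner_conj_symm (x : WithLp 2 (Hbar1 B × H)), hk, hk]
    simp
  · intro y
    simpa using surjective_sub_W hB hBi (m := 1) one_ne_zero y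
  · intro y
    obtain ⟨x, hx⟩ := surjective_sub_W hB hBi (m := -1) (by norm_num) (-y)
    refine ⟨x, ?_⟩
    rw [← neg_inj, ← hx]
    simp
    abel

end ResolventIdentities

/-! ### The surjection `τ φ - Θ ζ` of (H3.0) -/

section Boundary

variable {𝕜 H h : Type*} [RCLike 𝕜]
variable [NormedAddCommGroup H] [InnerProductSpace 𝕜 H] [CompleteSpace H]
variable [NormedAddCommGroup h] [InnerProductSpace 𝕜 h] {B : H →ₗ.[𝕜] H}

/-- The map `(φ, ζ) ↦ τ φ - Θ ζ` as a bounded operator. -/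
def tauSub (τ : Hbar2 B →L[𝕜] h) (Θ : h →L[𝕜] h) : Hbar2 B × h →L[𝕜] h :=
  τ.coprod (-Θ)

theorem tauSub_apply (τ : Hbar2 B →L[𝕜] h) (Θ : h →L[𝕜] h) (x : Hbar2 B × h) :
    tauSub τ Θ x = τ x.1 - Θ x.2 := by
  simp [tauSub, sub_eq_add_neg]

theorem tauSub_surjective {τ : Hbar2 B →L[𝕜] h} {Θ : h →L[𝕜] h}
    (H30 : LinearMap.range (tauTheta τ Θ) = ⊤) : Function.Surjective (tauSub τ Θ) := by
  intro y
  obtain ⟨⟨φ, f, ζ⟩, rfl⟩ := LinearMap.range_eq_top.1 H30 y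
  exact ⟨(φ, ζ), tauSub_apply τ Θ _⟩

end Boundary

/-! ### The maps `G(l)`, `Ḡ(l)` and the equation for the charge -/

section Charges

variable {𝕜 H h V : Type*} [RCLike 𝕜]
variable [NormedAddCommGroup H] [InnerProductSpace 𝕜 H] [CompleteSpace H]
variable [NormedAddCommGroup h] [InnerProductSpace 𝕜 h] [CompleteSpace h]
variable [AddCommGroup V] [Module 𝕜 V]
variable {B : H →ₗ.[𝕜] H}

theorem inner_Gl (hB : IsSelfAdjoint B) (τ : Hbar2 B →L[𝕜] h) {l : ℝ} (hl : l ≠ 0) (ζ : h) (f : H) :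
    inner 𝕜 (Gl hB τ hl ζ) f = inner 𝕜 ζ (τ (toHbar2 B (R0 hB hl f))) :=
  ContinuousLinearMap.adjoint_inner_left _ _ _

theorem inner_Gbar (hB : IsSelfAdjoint B) (τ : Hbar2 B →L[𝕜] h) {l : ℝ} (hl : l ≠ 0) (ζ : h)
    (φ : Hbar1 B) : inner 𝕜 (Gbar hB τ hl ζ) φ = inner 𝕜 ζ (τ (R0bar hB hl φ)) :=
  ContinuousLinearMap.adjoint_inner_left _ _ _

/-- `⟪ζ, τ φ⟫ = ⟪G(l) ζ, -Ā φ⟫ + l² ⟪Ḡ(l) ζ, φ⟫`. -/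
theorem inner_tau (hB : IsSelfAdjoint B) (τ : Hbar2 B →L[𝕜] h) {l : ℝ} (hl : l ≠ 0) (ζ : h)
    (φ : Hbar2 B) : inner 𝕜 ζ (τ φ) = -inner 𝕜 (Gl hB τ hl ζ) (Abar B φ)
      + (l : 𝕜) ^ 2 * inner 𝕜 (Gbar hB τ hl ζ) (Hbar2.incl B φ) := by
  rw [← inner_neg_right, inner_Gl, inner_Gbar, ← inner_smul_right, ← inner_add_right,
    ← map_smul, ← map_add, toHbar2_R0_add_R0bar]

/-- `B B̄ Ḡ(l) = G(l)`. -/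
theorem exists_Bbar_Gbar (hB : IsSelfAdjoint B) (τ : Hbar2 B →L[𝕜] h) {l : ℝ} (hl : l ≠ 0) (ζ : h) :
    ∃ hv : Bbar B (Gbar hB τ hl ζ) ∈ B.domain, B ⟨Bbar B (Gbar hB τ hl ζ), hv⟩ = Gl hB τ hl ζ :=
  mem_of_sa hB _ _ fun x => by
    -- For `x` in `D(B)`: `⟪G(l) ζ, x⟫ = ⟪ζ, τ R̄₀(l) x⟫ = ⟪B̄ Ḡ(l) ζ, B x⟫`, so `B̄ Ḡ(l) ζ` is in
    -- the domain of `B* = B`.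
    rw [inner_Gl, ← R0bar_coe, ← inner_Gbar, inner_Hbar1, Bbar_coe]

/-- `Ḡ(l)` with values in `H̄₂`. -/
def Gbar2 (hB : IsSelfAdjoint B) (τ : Hbar2 B →L[𝕜] h) {l : ℝ} (hl : l ≠ 0) : h →ₗ[𝕜] Hbar2 B :=
  (Gbar hB τ hl).toLinearMap.codRestrict (hbar2 B) fun ζ => (exists_Bbar_Gbar hB τ hl ζ).1

theorem incl_Gbar2 (hB : IsSelfAdjoint B) (τ : Hbar2 B →L[𝕜] h) {l : ℝ} (hl : l ≠ 0) (ζ : h) :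
    Hbar2.incl B (Gbar2 hB τ hl ζ) = Gbar hB τ hl ζ := rfl

theorem Abar_Gbar2 (hB : IsSelfAdjoint B) (τ : Hbar2 B →L[𝕜] h) {l : ℝ} (hl : l ≠ 0) (ζ : h) :
    Abar B (Gbar2 hB τ hl ζ) = -Gl hB τ hl ζ :=
  congrArg Neg.neg (exists_Bbar_Gbar hB τ hl ζ).2

/-- Shows that `τ Ḡ(l)` is symmetric and nonnegative, with an explicit form. -/
theorem inner_tau_Gbar2 (hB : IsSelfAdjoint B) (τ : Hbar2 B →L[𝕜] h) {l : ℝ} (hl : l ≠ 0)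
    (ζ η : h) : inner 𝕜 ζ (τ (Gbar2 hB τ hl η)) = inner 𝕜 (Gl hB τ hl ζ) (Gl hB τ hl η)
      + (l : 𝕜) ^ 2 * inner 𝕜 (Gbar hB τ hl ζ) (Gbar hB τ hl η) := by
  rw [inner_tau hB τ hl, Abar_Gbar2, incl_Gbar2, inner_neg_right, neg_neg]

/-- A vector `κ` for which `τ* κ` extends to a bounded functional on `H̄₁` is zero. -/
theorem eq_zero_of_tauStar (hB : IsSelfAdjoint B) (hBi : ∀ x : B.domain, B x = 0 → x = 0)
    {τ : Hbar2 B →L[𝕜] h} (hτ : DenseRange τ)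
    (H31 : Set.range (tauStar hB τ) ∩ HNegOne hB = {0}) {κ : h} (f : StrongDual 𝕜 (Hbar1 B))
    (hf : ∀ φ : Hbar2 B, inner 𝕜 κ (τ φ) = f (Hbar2.incl B φ)) : κ = 0 := by
  -- `H₁` maps boundedly to `H̄₁`, so `f` restricts to an element of `H₋₁`, and (H3.1) applies.
  have h1 : tauStar hB τ κ ∈ HNegOne hB :=
    ⟨f.comp (toHbar1L B), ContinuousLinearMap.ext fun u => (hf (toHbar2 B u)).symm⟩
  have h2 : tauStar hB τ κ = 0 := by
    have : tauStar hB τ κ ∈ ({0} : Set (StrongDual 𝕜 (H2 B))) := H31 ▸ ⟨⟨κ, rfl⟩, h1⟩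
    exact this
  have h3 : ∀ u : (sq B).domain, inner 𝕜 κ (τ (toHbar2 B u)) = 0 :=
    fun u => congrArg (fun g : StrongDual 𝕜 (H2 B) => g u) h2
  have hl : (1 : ℝ) ≠ 0 := one_ne_zero
  -- So far `τ* κ` vanishes only on `D(B²)`. This kills `G(1) κ`, then `Ḡ(1) κ` because `B B̄ Ḡ(1) =
  -- G(1)`, and by `inner_tau` the functional vanishes on all of `H̄₂`.
  have hG : Gl hB τ hl κ = 0 := by
    rw [← inner_self_eq_zero (𝕜 := 𝕜), inner_Gl, h3]
  have hGb : Gbar hB τ hl κ = 0 := by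
    obtain ⟨hv, hv'⟩ := exists_Bbar_Gbar hB τ hl κ
    rw [hG] at hv'
    exact Bbar_injective B ((congrArg Subtype.val (hBi _ hv')).trans (map_zero _).symm)
  refine hτ.eq_zero_of_inner_left 𝕜 fun φ => ?_
  rw [inner_tau hB τ hl, hG, hGb]
  simp

/-- If `G(l) κ` is in `D(B)`, then `B` can be moved onto it in `inner_tau`, and `τ* κ` becomes the
inner product in `H̄₁` with `G(l) κ + l² Ḡ(l) κ`. -/
theorem eq_zero_of_Gl_mem (hB : IsSelfAdjoint B) (hBi : ∀ x : B.domain, B x = 0 → x = 0)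
    {τ : Hbar2 B →L[𝕜] h} (hτ : DenseRange τ)
    (H31 : Set.range (tauStar hB τ) ∩ HNegOne hB = {0}) {l : ℝ} (hl : l ≠ 0) {κ : h}
    (hκ : Gl hB τ hl κ ∈ B.domain) : κ = 0 := by
  refine eq_zero_of_tauStar hB hBi hτ H31
    (innerSL 𝕜 (toHbar1 B ⟨_, hκ⟩ + ((l : 𝕜) ^ 2) • Gbar hB τ hl κ)) fun φ => ?_
  rw [inner_tau hB τ hl, innerSL_apply_apply, inner_add_left, inner_toHbar1 hB, inner_smul_left]
  simp

/-- `G(m) - G(l)` has values in the domain of `B`. -/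
theorem exists_Gl_sub (hB : IsSelfAdjoint B) (hBi : ∀ x : B.domain, B x = 0 → x = 0)
    (τ : Hbar2 B →L[𝕜] h) {l m : ℝ} (hl : l ≠ 0) (hm : m ≠ 0) (ζ : h) :
    ∃ x : B.domain, (x : H) = Gl hB τ hm ζ - Gl hB τ hl ζ ∧
      toHbar1 B x = ((l : 𝕜) ^ 2) • Gbar hB τ hl ζ - ((m : 𝕜) ^ 2) • Gbar hB τ hm ζ := by
  obtain ⟨hx, h⟩ := mem_of_sa hB (Gl hB τ hm ζ - Gl hB τ hl ζ)
    (Bbar B (((l : 𝕜) ^ 2) • Gbar hB τ hl ζ - ((m : 𝕜) ^ 2) • Gbar hB τ hm ζ)) fun x => by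
      -- Each test vector `x` in `D(B)` is `B̄ φ` with `φ` in `H̄₂`; subtract `inner_tau` at `l` and
      -- at `m` for this `φ`.
      obtain ⟨φ, hφ⟩ := Bbar_surjective hB hBi (x : H)
      have hφ2 : φ ∈ hbar2 B := by change Bbar B φ ∈ B.domain; rw [hφ]; exact x.2
      have hA : Abar B (Hbar2.mk φ hφ2) = -B x := by
        rw [Abar_eq]
        congr 2
        exact Subtype.ext hφ
      have e1 := inner_tau hB τ hl ζ (Hbar2.mk φ hφ2)
      rw [inner_tau hB τ hm ζ (Hbar2.mk φ hφ2)] at e1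
      rw [← hφ, ← inner_Hbar1, inner_sub_left, inner_sub_left, inner_smul_left, inner_smul_left]
      rw [hA, inner_neg_right, inner_neg_right] at e1
      simp only [map_pow, RCLike.conj_ofReal]
      have hi : Hbar2.incl B (Hbar2.mk φ hφ2) = φ := rfl
      rw [hi] at e1
      linear_combination -e1
  exact ⟨⟨_, hx⟩, rfl, Bbar_injective B (by rw [Bbar_coe, h])⟩

theorem G_apply (hB : IsSelfAdjoint B) (τ : Hbar2 B →L[𝕜] h) (i₀ : H →ₗ[𝕜] V)
    (i₁ : Hbar1 B →ₗ[𝕜] V) {l : ℝ} (hl : l ≠ 0) (ζ : h) :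
    G hB τ i₀ i₁ hl ζ = i₀ (Gl hB τ hl ζ) + ((l : 𝕜) ^ 2) • i₁ (Gbar hB τ hl ζ) := rfl

theorem G_eq_G (hB : IsSelfAdjoint B) (hBi : ∀ x : B.domain, B x = 0 → x = 0)
    (τ : Hbar2 B →L[𝕜] h) {i₀ : H →ₗ[𝕜] V} {i₁ : Hbar1 B →ₗ[𝕜] V} (H32 : IsCommonSpace B i₀ i₁)
    {l m : ℝ} (hl : l ≠ 0) (hm : m ≠ 0) : G hB τ i₀ i₁ hm = G hB τ i₀ i₁ hl := by
  ext ζ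
  obtain ⟨x, hx, hx'⟩ := exists_Gl_sub hB hBi τ hl hm ζ
  have h := H32.compat x
  rw [hx, hx', map_sub, map_sub, map_smul, map_smul] at h
  rw [G_apply, G_apply, ← sub_eq_zero]
  rw [← sub_eq_zero] at h
  rw [← h]
  abel

/-- The intersection of `H` and `K̄₁`. -/
theorem eq_sumMap_iff (hB : IsSelfAdjoint B) (τ : Hbar2 B →L[𝕜] h) {i₀ : H →ₗ[𝕜] V}
    {i₁ : Hbar1 B →ₗ[𝕜] V} (H32 : IsCommonSpace B i₀ i₁) {l : ℝ} (hl : l ≠ 0) (ψ : H)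
    (φ : Hbar1 B) (ξ : h) : i₀ ψ = sumMap i₁ (G hB τ i₀ i₁ hl) (φ, ξ) ↔
      ∃ ψ' : B.domain, ψ = (ψ' : H) + Gl hB τ hl ξ ∧
        φ = toHbar1 B ψ' - ((l : 𝕜) ^ 2) • Gbar hB τ hl ξ := by
  have h0 : sumMap i₁ (G hB τ i₀ i₁ hl) (φ, ξ) =
      i₁ φ + (i₀ (Gl hB τ hl ξ) + ((l : 𝕜) ^ 2) • i₁ (Gbar hB τ hl ξ)) := by
    simp [sumMap, G_apply]
  rw [h0]
  constructor
  · intro h1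
    -- The part in `H` and the part in `H̄₁` are separated; being equal in `V`, both are the same
    -- vector `ψ'` of `D(B)`.
    have h2 : i₀ (ψ - Gl hB τ hl ξ) = i₁ (φ + ((l : 𝕜) ^ 2) • Gbar hB τ hl ξ) := by
      rw [map_sub, h1, map_add, map_smul]; abel
    have hx := H32.inter _ _ h2
    refine ⟨⟨_, hx⟩, by simp, ?_⟩
    rw [eq_sub_iff_add_eq]
    exact H32.inj₁ (h2.symm.trans (H32.compat ⟨_, hx⟩))
  · rintro ⟨ψ', rfl, rfl⟩
    rw [map_add, H32.compat, map_sub, map_smul]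
    abel

theorem sumMap_injective (hB : IsSelfAdjoint B) (hBi : ∀ x : B.domain, B x = 0 → x = 0)
    {τ : Hbar2 B →L[𝕜] h} (hτ : DenseRange τ)
    (H31 : Set.range (tauStar hB τ) ∩ HNegOne hB = {0}) {i₀ : H →ₗ[𝕜] V}
    {i₁ : Hbar1 B →ₗ[𝕜] V} (H32 : IsCommonSpace B i₀ i₁) {l : ℝ} (hl : l ≠ 0) :
    Function.Injective (sumMap i₁ (G hB τ i₀ i₁ hl)) := by
  rw [injective_iff_map_eq_zero]
  rintro ⟨φ, ζ⟩ h0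
  obtain ⟨ψ', h1, h2⟩ := (eq_sumMap_iff hB τ H32 hl 0 φ ζ).1 (by rw [h0, map_zero])
  have h3 : Gl hB τ hl ζ = ((-ψ' : B.domain) : H) := (neg_eq_of_add_eq_zero_right h1.symm).symm
  have hζ : ζ = 0 := eq_zero_of_Gl_mem hB hBi hτ H31 hl (by rw [h3]; exact (-ψ').2)
  subst hζ
  have h4 : ψ' = 0 := Subtype.ext (by simpa using h1.symm)
  simp [h2, h4]

/-- The operator `Θ + m² τ Ḡ(m)` is onto. -/
theorem exists_charge (hB : IsSelfAdjoint B) {Θ : h →L[𝕜] h} (hΘ : Θ.IsPositive)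
    {τ : Hbar2 B →L[𝕜] h} (H30 : LinearMap.range (tauTheta τ Θ) = ⊤) {m : ℝ} (hm : m ≠ 0) (y : h) :
    ∃ ξ : h, Θ ξ + ((m : 𝕜) ^ 2) • τ (Gbar2 hB τ hm ξ) = y := by
  have := completeSpace_Hbar2 hB
  -- Open mapping theorem: each `x` is `τ φ - Θ ζ` with `φ`, `ζ` bounded by `C ‖x‖`.
  obtain ⟨C, hC, hS⟩ := (tauSub τ Θ).exists_preimage_norm_le (tauSub_surjective H30)
  let P : h →ₗ[𝕜] h := Θ.toLinearMap + ((m : 𝕜) ^ 2) • τ.toLinearMap ∘ₗ Gbar2 hB τ hm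
  have hP : ∀ x, P x = Θ x + ((m : 𝕜) ^ 2) • τ (Gbar2 hB τ hm x) := fun x => rfl
  have hsymm : ∀ x z, inner 𝕜 (P x) z = inner 𝕜 x (P z) := by
    intro x z
    rw [hP, hP, inner_add_left, inner_add_right, inner_smul_left, inner_smul_right,
      inner_tau_Gbar2, ← inner_conj_symm (τ _), inner_tau_Gbar2]
    have hs : inner 𝕜 (Θ x) z = inner 𝕜 x (Θ z) := hΘ.isSymmetric x z
    simp [hs]
  -- Hellinger–Toeplitz: symmetric and everywhere defined.
  have hcont : Continuous P := by
    have : LinearMap.IsSymmetric P := hsymm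
    exact this.continuous
  let PL : h →L[𝕜] h := ⟨P, hcont⟩
  have hre : ∀ x, RCLike.re (inner 𝕜 (P x) x) = RCLike.re (inner 𝕜 (Θ x) x)
      + m ^ 2 * (‖Gl hB τ hm x‖ ^ 2 + m ^ 2 * ‖Gbar hB τ hm x‖ ^ 2) := by
    intro x
    have e : inner 𝕜 (P x) x = inner 𝕜 (Θ x) x + ((m ^ 2 : ℝ) : 𝕜) *
        (inner 𝕜 (Gl hB τ hm x) (Gl hB τ hm x)
          + ((m ^ 2 : ℝ) : 𝕜) * inner 𝕜 (Gbar hB τ hm x) (Gbar hB τ hm x)) := by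
      rw [hsymm, hP, inner_add_right, inner_smul_right, inner_tau_Gbar2]
      have hs : inner 𝕜 (Θ x) x = inner 𝕜 x (Θ x) := hΘ.isSymmetric x x
      rw [hs]
      push_cast
      ring
    rw [e, map_add, RCLike.re_ofReal_mul, map_add, RCLike.re_ofReal_mul, inner_self_eq_norm_sq,
      inner_self_eq_norm_sq]
  -- Expand `⟪x, x⟫ = ⟪x, τ φ - Θ ζ⟫` by `inner_tau` and divide by `‖x‖`.
  have hlow : ∀ x, ‖x‖ ≤ C * (‖Gl hB τ hm x‖ + m ^ 2 * ‖Gbar hB τ hm x‖ + ‖Θ x‖) := by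
    intro x
    obtain ⟨⟨φ, ζ⟩, hx, hn⟩ := hS x
    rw [tauSub_apply] at hx
    have n1 : ‖φ‖ ≤ C * ‖x‖ := (norm_fst_le (φ, ζ)).trans hn
    have n2 : ‖ζ‖ ≤ C * ‖x‖ := (norm_snd_le (φ, ζ)).trans hn
    have e : inner 𝕜 x x = -inner 𝕜 (Gl hB τ hm x) (Abar B φ)
        + (m : 𝕜) ^ 2 * inner 𝕜 (Gbar hB τ hm x) (Hbar2.incl B φ) - inner 𝕜 (Θ x) ζ := by
      have hs : inner 𝕜 (Θ x) ζ = inner 𝕜 x (Θ ζ) := hΘ.isSymmetric x ζ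
      rw [hs, ← inner_tau, ← inner_sub_right, hx]
    have b1 : ‖inner 𝕜 (Gl hB τ hm x) (Abar B φ)‖ ≤ ‖Gl hB τ hm x‖ * (C * ‖x‖) :=
      (norm_inner_le_norm _ _).trans
        (mul_le_mul_of_nonneg_left ((norm_Abar_le φ).trans n1) (norm_nonneg _))
    have b2 : ‖inner 𝕜 (Gbar hB τ hm x) (Hbar2.incl B φ)‖ ≤ ‖Gbar hB τ hm x‖ * (C * ‖x‖) :=
      (norm_inner_le_norm _ _).trans
        (mul_le_mul_of_nonneg_left ((norm_incl_le φ).trans n1) (norm_nonneg _))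
    have b3 : ‖inner 𝕜 (Θ x) ζ‖ ≤ ‖Θ x‖ * (C * ‖x‖) :=
      (norm_inner_le_norm _ _).trans (mul_le_mul_of_nonneg_left n2 (norm_nonneg _))
    have hmn : ‖(m : 𝕜) ^ 2‖ = m ^ 2 := by simp
    have b4 : ‖x‖ ^ 2 ≤ ‖Gl hB τ hm x‖ * (C * ‖x‖) + m ^ 2 * (‖Gbar hB τ hm x‖ * (C * ‖x‖))
        + ‖Θ x‖ * (C * ‖x‖) := by
      have : ‖x‖ ^ 2 = ‖inner 𝕜 x x‖ := by
        rw [inner_self_eq_norm_sq_to_K]; simp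
      rw [this, e]
      refine (norm_sub_le _ _).trans (add_le_add ((norm_add_le _ _).trans (add_le_add ?_ ?_)) b3)
      · rwa [norm_neg]
      · rw [norm_mul, hmn]
        exact mul_le_mul_of_nonneg_left b2 (sq_nonneg m)
    rcases eq_or_lt_of_le (norm_nonneg x) with h0 | h0
    · rw [← h0]; positivity
    · refine le_of_mul_le_mul_right ?_ h0
      calc ‖x‖ * ‖x‖ = ‖x‖ ^ 2 := by ring
        _ ≤ _ := b4
        _ = _ := by ring
  have hm2 : 0 < m ^ 2 := by positivity
  -- The summands of `D` serve in turn for `‖G(m) x‖²`, `(m² ‖Ḡ(m) x‖)²` and `‖Θ x‖²`, each bounded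
  -- by a multiple of the form. The factor 3 below comes from squaring a sum of three terms.
  let D : ℝ := (m ^ 2)⁻¹ + 1 + ‖Θ‖
  have hD : 0 < D := by positivity
  have hcoer : ∀ x, ‖x‖ ^ 2 ≤ 3 * C ^ 2 * D * RCLike.re (inner 𝕜 (P x) x) := by
    intro x
    have t1 := hΘ.re_inner_nonneg_left x
    have t2 := norm_sq_le_mul_re_inner hΘ x
    rw [hre]
    generalize RCLike.re (inner 𝕜 (Θ x) x) = t at *
    have hl := hlow x
    generalize ‖Gl hB τ hm x‖ = a at *
    generalize ‖Θ x‖ = c at *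
    generalize ‖Gbar hB τ hm x‖ = b at *
    have s1 : ‖x‖ ^ 2 ≤ C ^ 2 * (a + m ^ 2 * b + c) ^ 2 := by
      rw [← mul_pow]
      exact pow_le_pow_left₀ (norm_nonneg _) hl 2
    have s2 : (a + m ^ 2 * b + c) ^ 2 ≤ 3 * (a ^ 2 + (m ^ 2 * b) ^ 2 + c ^ 2) := by
      nlinarith [sq_nonneg (a - m ^ 2 * b), sq_nonneg (a - c), sq_nonneg (m ^ 2 * b - c)]
    have s3 : a ^ 2 + (m ^ 2 * b) ^ 2 + c ^ 2 ≤
        D * (t + m ^ 2 * (a ^ 2 + m ^ 2 * b ^ 2)) := by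
      have r1 : (m ^ 2)⁻¹ * (m ^ 2 * a ^ 2) = a ^ 2 := by field_simp
      have r2 : D * (t + m ^ 2 * (a ^ 2 + m ^ 2 * b ^ 2)) =
          (m ^ 2)⁻¹ * (m ^ 2 * a ^ 2) + (m ^ 2 * b) ^ 2 + ‖Θ‖ * t + ((m ^ 2)⁻¹ * t + t +
            (m ^ 2)⁻¹ * (m ^ 2 * b) ^ 2 + m ^ 2 * a ^ 2
            + ‖Θ‖ * (m ^ 2 * (a ^ 2 + m ^ 2 * b ^ 2))) := by
        simp only [D]; ring
      rw [r2, r1]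
      have : 0 ≤ (m ^ 2)⁻¹ * t + t + (m ^ 2)⁻¹ * (m ^ 2 * b) ^ 2 + m ^ 2 * a ^ 2
            + ‖Θ‖ * (m ^ 2 * (a ^ 2 + m ^ 2 * b ^ 2)) := by positivity
      linarith
    calc ‖x‖ ^ 2 ≤ C ^ 2 * (a + m ^ 2 * b + c) ^ 2 := s1
      _ ≤ C ^ 2 * (3 * (D * (t + m ^ 2 * (a ^ 2 + m ^ 2 * b ^ 2)))) := by
        refine mul_le_mul_of_nonneg_left (s2.trans ?_) (sq_nonneg C)
        linarith
      _ = _ := by ring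
  have hE : 0 < 3 * C ^ 2 * D := by positivity
  have hunit : IsUnit PL := by
    refine ContinuousLinearMap.isUnit_of_forall_le_norm_inner_map PL
      (c := (Real.toNNReal (3 * C ^ 2 * D))⁻¹) (by simpa using hE) fun x => ?_
    rw [NNReal.coe_inv, Real.coe_toNNReal _ hE.le, mul_inv_le_iff₀ hE, mul_comm]
    exact (hcoer x).trans (mul_le_mul_of_nonneg_left (RCLike.re_le_norm _) hE.le)
  obtain ⟨ξ, hξ⟩ := (ContinuousLinearMap.isUnit_iff_bijective.1 hunit).2 y
  exact ⟨ξ, hξ⟩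

end Charges

/-! ### The norm of `h_Θ` -/

section HThetaNorm

variable {𝕜 h : Type*} [RCLike 𝕜] [NormedAddCommGroup h] [InnerProductSpace 𝕜 h] [CompleteSpace h]
variable (Θ : h →L[𝕜] h) (hΘ : Θ.IsPositive) (hΘi : Function.Injective Θ)

theorem HTheta.inner_eq (ζ η : HTheta Θ hΘ hΘi) :
    inner 𝕜 ζ η = inner 𝕜 (Θ (HTheta.val Θ hΘ hΘi ζ)) (HTheta.val Θ hΘ hΘi η) := rfl

theorem HTheta.norm_sq (ζ : HTheta Θ hΘ hΘi) :
    ‖ζ‖ ^ 2 = RCLike.re (inner 𝕜 (Θ (HTheta.val Θ hΘ hΘi ζ)) (HTheta.val Θ hΘ hΘi ζ)) := by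
  rw [← HTheta.inner_eq, inner_self_eq_norm_sq]

theorem re_inner_le_opNorm_mul_sq (ζ : h) :
    RCLike.re (inner 𝕜 (Θ ζ) ζ) ≤ ‖Θ‖ * ‖ζ‖ ^ 2 := by
  refine (re_inner_le_norm _ _).trans ?_
  nlinarith [Θ.le_opNorm ζ, norm_nonneg ζ]

/-- A bijective bounded `Θ` has a bounded inverse, so `‖ζ‖ ≤ C ‖Θ ζ‖`, and `‖Θ ζ‖² ≤ ‖Θ‖ ⟪Θ ζ, ζ⟫`;
the two norms are equivalent. The constant `1 + ‖Θ‖` stands in for the square root of `‖Θ‖`. -/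
theorem completeSpace_HTheta (hs : Function.Surjective Θ) : CompleteSpace (HTheta Θ hΘ hΘi) := by
  obtain ⟨C, hC, hS⟩ := Θ.exists_preimage_norm_le hs
  have hpos : (0 : ℝ) ≤ ‖Θ‖ := norm_nonneg _
  let e := (HTheta.val Θ hΘ hΘi).toContinuousLinearEquivOfBounds (C * (1 + ‖Θ‖)) (1 + ‖Θ‖)
    (fun ζ => by
      obtain ⟨x, hx, hn⟩ := hS (Θ (HTheta.val Θ hΘ hΘi ζ))
      rw [hΘi hx] at hn
      refine hn.trans ?_
      rw [mul_assoc]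
      refine mul_le_mul_of_nonneg_left (le_of_sq_le_sq ?_ (by positivity)) hC.le
      refine (norm_sq_le_mul_re_inner hΘ _).trans ?_
      rw [← HTheta.norm_sq, mul_pow]
      exact mul_le_mul_of_nonneg_right (by nlinarith) (sq_nonneg _))
    (fun ζ => by
      refine le_of_sq_le_sq ?_ (by positivity)
      rw [HTheta.norm_sq, LinearEquiv.apply_symm_apply, mul_pow]
      exact (re_inner_le_opNorm_mul_sq Θ ζ).trans
        (mul_le_mul_of_nonneg_right (by nlinarith) (sq_nonneg _)))
  exact (completeSpace_congr (e := e.toEquiv) e.isUniformEmbedding).2 inferInstance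

end HThetaNorm

/-! ### Coordinates on `K̄₁ ⊕ H` and the unitary map -/

section Perturbed

variable {𝕜 H h V : Type*} [RCLike 𝕜]
variable [NormedAddCommGroup H] [InnerProductSpace 𝕜 H] [CompleteSpace H]
variable [NormedAddCommGroup h] [InnerProductSpace 𝕜 h] [CompleteSpace h]
variable [AddCommGroup V] [Module 𝕜 V]
variable {B : H →ₗ.[𝕜] H}

variable (i₀ : H →ₗ[𝕜] V) (i₁ : Hbar1 B →ₗ[𝕜] V) (g : h →ₗ[𝕜] V) (Θ : h →L[𝕜] h)
  (hΘ : Θ.IsPositive) (hΘi : Function.Injective Θ) (hU : Function.Injective (sumMap i₁ g))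

/-- The vector `(φ + g ζ, ψ)` of `K̄₁ ⊕ H`. -/
def kvec (φ : Hbar1 B) (ζ : h) (ψ : H) : KTot i₁ g Θ hΘ hΘi hU :=
  WithLp.toLp 2 (Kbar1.equiv i₁ g Θ hΘ hΘi hU (φ, ζ), ψ)

theorem Kbar1.reg_equiv (p : Hbar1 B × h) :
    Kbar1.reg i₁ g Θ hΘ hΘi hU (Kbar1.equiv i₁ g Θ hΘ hΘi hU p) = p.1 :=
  congrArg Prod.fst ((Kbar1.equiv i₁ g Θ hΘ hΘi hU).symm_apply_apply p)

theorem Kbar1.charge_equiv (p : Hbar1 B × h) :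
    Kbar1.charge i₁ g Θ hΘ hΘi hU (Kbar1.equiv i₁ g Θ hΘ hΘi hU p) = p.2 :=
  congrArg Prod.snd ((Kbar1.equiv i₁ g Θ hΘ hΘi hU).symm_apply_apply p)

theorem Kbar1.equiv_reg_charge (k : Kbar1 i₁ g Θ hΘ hΘi hU) :
    Kbar1.equiv i₁ g Θ hΘ hΘi hU
      (Kbar1.reg i₁ g Θ hΘ hΘi hU k, Kbar1.charge i₁ g Θ hΘ hΘi hU k) = k :=
  (Kbar1.equiv i₁ g Θ hΘ hΘi hU).apply_symm_apply k

theorem Kbar1.mk_sumMap {v : V} (hv : v ∈ LinearMap.range (sumMap i₁ g)) (p : Hbar1 B × h)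
    (h : v = sumMap i₁ g p) :
    Kbar1.mk i₁ g Θ hΘ hΘi hU v hv = Kbar1.equiv i₁ g Θ hΘ hΘi hU p :=
  Subtype.ext h

theorem kvec_reg_charge (x : KTot i₁ g Θ hΘ hΘi hU) :
    kvec i₁ g Θ hΘ hΘi hU (Kbar1.reg i₁ g Θ hΘ hΘi hU x.fst)
      (Kbar1.charge i₁ g Θ hΘ hΘi hU x.fst) x.snd = x :=
  WithLp.ofLp_injective 2 (Prod.ext (Kbar1.equiv_reg_charge i₁ g Θ hΘ hΘi hU x.fst) rfl)

theorem exists_kvec (x : KTot i₁ g Θ hΘ hΘi hU) : ∃ φ ζ ψ, kvec i₁ g Θ hΘ hΘi hU φ ζ ψ = x :=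
  ⟨_, _, _, kvec_reg_charge i₁ g Θ hΘ hΘi hU x⟩

theorem smul_kvec_sub_kvec (c : 𝕜) (φ φ' : Hbar1 B) (ζ ζ' : h) (ψ ψ' : H) :
    c • kvec i₁ g Θ hΘ hΘi hU φ ζ ψ - kvec i₁ g Θ hΘ hΘi hU φ' ζ' ψ' =
      kvec i₁ g Θ hΘ hΘi hU (c • φ - φ') (c • ζ - ζ') (c • ψ - ψ') :=
  WithLp.ofLp_injective 2 <| Prod.ext
    (((Kbar1.equiv i₁ g Θ hΘ hΘi hU).map_sub (c • (φ, ζ)) (φ', ζ')).trans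
      (by rw [map_smul]; rfl)).symm rfl

theorem inner_Kbar1 (p q : Hbar1 B × h) :
    inner 𝕜 (Kbar1.equiv i₁ g Θ hΘ hΘi hU p) (Kbar1.equiv i₁ g Θ hΘ hΘi hU q) =
      inner 𝕜 p.1 q.1 + inner 𝕜 (Θ p.2) q.2 := by
  have e : ∀ p, Kbar1.emb i₁ g Θ hΘ hΘi hU (Kbar1.equiv i₁ g Θ hΘ hΘi hU p) =
      WithLp.toLp 2 (p.1, (HTheta.val Θ hΘ hΘi).symm p.2) := fun p =>
    congrArg (WithLp.toLp 2) ((Kbar1.equiv i₁ g Θ hΘ hΘi hU).symm_apply_apply p)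
  change inner 𝕜 (Kbar1.emb i₁ g Θ hΘ hΘi hU _) (Kbar1.emb i₁ g Θ hΘ hΘi hU _) = _
  rw [e, e, WithLp.prod_inner_apply]
  rfl

theorem inner_kvec (φ φ' : Hbar1 B) (ζ ζ' : h) (ψ ψ' : H) :
    inner 𝕜 (kvec i₁ g Θ hΘ hΘi hU φ ζ ψ) (kvec i₁ g Θ hΘ hΘi hU φ' ζ' ψ') =
      inner 𝕜 φ φ' + inner 𝕜 (Θ ζ) ζ' + inner 𝕜 ψ ψ' := by
  rw [WithLp.prod_inner_apply]
  exact congrArg (· + _) (inner_Kbar1 i₁ g Θ hΘ hΘi hU (φ, ζ) (φ', ζ'))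

theorem norm_kvec_sq (φ : Hbar1 B) (ζ : h) (ψ : H) :
    ‖kvec i₁ g Θ hΘ hΘi hU φ ζ ψ‖ ^ 2 =
      ‖φ‖ ^ 2 + RCLike.re (inner 𝕜 (Θ ζ) ζ) + ‖ψ‖ ^ 2 := by
  rw [← inner_self_eq_norm_sq (𝕜 := 𝕜), inner_kvec, map_add, map_add, inner_self_eq_norm_sq,
    inner_self_eq_norm_sq]

/-- `(φ, ζ, ψ) ↦ (φ + g ζ, ψ)` as a bounded operator. -/
def kvecL : Hbar1 B × h × H →L[𝕜] KTot i₁ g Θ hΘ hΘi hU :=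
  LinearMap.mkContinuous
    ((WithLp.linearEquiv 2 𝕜 (Kbar1 i₁ g Θ hΘ hΘi hU × H)).symm.toLinearMap ∘ₗ
      ((Kbar1.equiv i₁ g Θ hΘ hΘi hU).toLinearMap.prodMap LinearMap.id) ∘ₗ
        (LinearEquiv.prodAssoc 𝕜 (Hbar1 B) h H).symm.toLinearMap) (2 + ‖Θ‖) fun p => by
    -- Here `h` carries its own norm, not that of `h_Θ`. The squared norm of the image is at most
    -- `(2 + ‖Θ‖) ‖p‖²`.
    refine le_of_sq_le_sq ?_ (by positivity)
    change ‖kvec i₁ g Θ hΘ hΘi hU p.1 p.2.1 p.2.2‖ ^ 2 ≤ _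
    rw [norm_kvec_sq, mul_pow]
    have h0 : (0 : ℝ) ≤ ‖Θ‖ := norm_nonneg _
    have h1 : ‖p.1‖ ^ 2 ≤ ‖p‖ ^ 2 := pow_le_pow_left₀ (norm_nonneg _) (norm_fst_le p) 2
    have h2 : ‖p.2.1‖ ^ 2 ≤ ‖p‖ ^ 2 :=
      pow_le_pow_left₀ (norm_nonneg _) ((norm_fst_le p.2).trans (norm_snd_le p)) 2
    have h3 : ‖p.2.2‖ ^ 2 ≤ ‖p‖ ^ 2 :=
      pow_le_pow_left₀ (norm_nonneg _) ((norm_snd_le p.2).trans (norm_snd_le p)) 2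
    have h4 := (re_inner_le_opNorm_mul_sq Θ p.2.1).trans (mul_le_mul_of_nonneg_left h2 h0)
    nlinarith [mul_nonneg h0 (sq_nonneg ‖p‖), mul_nonneg (sq_nonneg ‖Θ‖) (sq_nonneg ‖p‖)]

theorem incl_eq_kvec (x : WithLp 2 (Hbar1 B × H)) :
    incl i₁ g Θ hΘ hΘi hU x = kvec i₁ g Θ hΘ hΘi hU x.fst 0 x.snd := rfl

theorem norm_incl (x : WithLp 2 (Hbar1 B × H)) : ‖incl i₁ g Θ hΘ hΘi hU x‖ = ‖x‖ := by
  rw [← sq_eq_sq₀ (norm_nonneg _) (norm_nonneg _), incl_eq_kvec, norm_kvec_sq,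
    WithLp.prod_norm_sq_eq_of_L2]
  simp

/-- The unitary map `U(φ₀, ψ, ζ) = (φ₀ + g ζ, ψ)`. -/
def unitary : HTot B Θ hΘ hΘi ≃ₗᵢ[𝕜] KTot i₁ g Θ hΘ hΘi hU where
  toFun x := kvec i₁ g Θ hΘ hΘi hU x.fst (HTheta.val Θ hΘ hΘi x.snd.snd) x.snd.fst
  invFun y := WithLp.toLp 2 (Kbar1.reg i₁ g Θ hΘ hΘi hU y.fst, WithLp.toLp 2 (y.snd,
    (HTheta.val Θ hΘ hΘi).symm (Kbar1.charge i₁ g Θ hΘ hΘi hU y.fst)))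
  map_add' x y := (kvecL i₁ g Θ hΘ hΘi hU).map_add
    (x.fst, HTheta.val Θ hΘ hΘi x.snd.snd, x.snd.fst)
    (y.fst, HTheta.val Θ hΘ hΘi y.snd.snd, y.snd.fst)
  map_smul' c x := (kvecL i₁ g Θ hΘ hΘi hU).map_smul c
    (x.fst, HTheta.val Θ hΘ hΘi x.snd.snd, x.snd.fst)
  left_inv x := by
    refine WithLp.ofLp_injective 2 (Prod.ext ?_ (WithLp.ofLp_injective 2 (Prod.ext rfl ?_)))
    · exact Kbar1.reg_equiv i₁ g Θ hΘ hΘi hU _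
    · exact congrArg (HTheta.val Θ hΘ hΘi).symm (Kbar1.charge_equiv i₁ g Θ hΘ hΘi hU _)
  right_inv y := kvec_reg_charge i₁ g Θ hΘ hΘi hU y
  norm_map' x := by
    change ‖kvec i₁ g Θ hΘ hΘi hU x.fst (HTheta.val Θ hΘ hΘi x.snd.snd) x.snd.fst‖ = ‖x‖
    rw [← sq_eq_sq₀ (norm_nonneg _) (norm_nonneg _), norm_kvec_sq,
      WithLp.prod_norm_sq_eq_of_L2, WithLp.prod_norm_sq_eq_of_L2, HTheta.norm_sq]
    ring

theorem unitary_apply (φ : Hbar1 B) (ψ : H) (ζ : h) :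
    unitary i₁ g Θ hΘ hΘi hU
      (WithLp.toLp 2 (φ, WithLp.toLp 2 (ψ, (HTheta.val Θ hΘ hΘi).symm ζ))) =
      kvec i₁ g Θ hΘ hΘi hU φ ζ ψ := rfl

theorem completeSpace_KTot (hs : Function.Surjective Θ) :
    CompleteSpace (KTot i₁ g Θ hΘ hΘi hU) := by
  have := completeSpace_HTheta Θ hΘ hΘi hs
  exact (completeSpace_congr (e := (unitary i₁ g Θ hΘ hΘi hU).toEquiv)
    (unitary i₁ g Θ hΘ hΘi hU).isometry.isUniformEmbedding).1 inferInstance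

end Perturbed

/-! ### Skew-adjointness of `W_Θ` and comparison with `W` -/

section SkewAdjointness

variable {𝕜 H h V : Type*} [RCLike 𝕜]
variable [NormedAddCommGroup H] [InnerProductSpace 𝕜 H] [CompleteSpace H]
variable [NormedAddCommGroup h] [InnerProductSpace 𝕜 h] [CompleteSpace h]
variable [AddCommGroup V] [Module 𝕜 V]
variable {B : H →ₗ.[𝕜] H} {Θ : h →L[𝕜] h} {τ : Hbar2 B →L[𝕜] h}
variable {i₀ : H →ₗ[𝕜] V} {i₁ : Hbar1 B →ₗ[𝕜] V} {g : h →ₗ[𝕜] V}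

/-- The graph of `W_Θ`, in terms of `G(m)` and `Ḡ(m)`. -/
theorem mem_graph_WTheta (hB : IsSelfAdjoint B) (hΘ : Θ.IsPositive) (hΘi : Function.Injective Θ)
    (H32 : IsCommonSpace B i₀ i₁) (hU : Function.Injective (sumMap i₁ g)) {m : ℝ} (hm : m ≠ 0)
    (hg : g = G hB τ i₀ i₁ hm) (x y : KTot i₁ g Θ hΘ hΘi hU) :
    (x, y) ∈ (WTheta i₀ i₁ g Θ hΘ hΘi hU τ).graph ↔
      ∃ (φ₀ : Hbar2 B) (ψ' : B.domain) (ζ ξ : h), Θ ζ = τ φ₀ ∧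
        x = kvec i₁ g Θ hΘ hΘi hU (Hbar2.incl B φ₀) ζ ((ψ' : H) + Gl hB τ hm ξ) ∧
        y = kvec i₁ g Θ hΘ hΘi hU (toHbar1 B ψ' - ((m : 𝕜) ^ 2) • Gbar hB τ hm ξ) ξ
          (Abar B φ₀) := by
  subst hg
  rw [LinearPMap.mem_graph_iff]
  constructor
  · rintro ⟨⟨x, hx⟩, rfl, rfl⟩
    obtain ⟨⟨φ₀, h1, h2⟩, ⟨⟨φ₁, ξ⟩, h3⟩⟩ := id hx
    obtain ⟨ψ', hψ, hφ⟩ := (eq_sumMap_iff hB τ H32 hm x.snd φ₁ ξ).1 h3.symm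
    refine ⟨φ₀, ψ', _, ξ, h2, ?_, ?_⟩
    · rw [h1, ← hψ, kvec_reg_charge]
    · rw [← hφ]
      exact WithLp.ofLp_injective 2 (Prod.ext (Kbar1.mk_sumMap i₁ _ Θ hΘ hΘi hU _ _ h3.symm)
        (congrArg (Abar B) (Subtype.ext h1.symm)))
  · rintro ⟨φ₀, ψ', ζ, ξ, h1, rfl, rfl⟩
    have h3 := (eq_sumMap_iff hB τ H32 hm _ _ ξ).2 ⟨ψ', rfl, rfl⟩
    have hr := Kbar1.reg_equiv i₁ (G hB τ i₀ i₁ hm) Θ hΘ hΘi hU (Hbar2.incl B φ₀, ζ)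
    have hc := Kbar1.charge_equiv i₁ (G hB τ i₀ i₁ hm) Θ hΘ hΘi hU (Hbar2.incl B φ₀, ζ)
    exact ⟨⟨kvec i₁ _ Θ hΘ hΘi hU (Hbar2.incl B φ₀) ζ ((ψ' : H) + Gl hB τ hm ξ),
      ⟨φ₀, hr.symm, (congrArg Θ hc).trans h1⟩, ⟨_, h3.symm⟩⟩, rfl,
      WithLp.ofLp_injective 2 (Prod.ext (Kbar1.mk_sumMap i₁ _ Θ hΘ hΘi hU _ _ h3)
        (congrArg (Abar B) (Subtype.ext hr)))⟩

theorem surjective_sub_WTheta (hB : IsSelfAdjoint B) (hBi : ∀ x : B.domain, B x = 0 → x = 0)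
    (hΘ : Θ.IsPositive) (hΘi : Function.Injective Θ)
    (H30 : LinearMap.range (tauTheta τ Θ) = ⊤) (H32 : IsCommonSpace B i₀ i₁)
    (hU : Function.Injective (sumMap i₁ g)) {m : ℝ} (hm : m ≠ 0)
    (hg : g = G hB τ i₀ i₁ hm) (y : KTot i₁ g Θ hΘ hΘi hU) :
    ∃ x : (WTheta i₀ i₁ g Θ hΘ hΘi hU τ).domain,
      (m : 𝕜) • (x : KTot i₁ g Θ hΘ hΘi hU) - WTheta i₀ i₁ g Θ hΘ hΘi hU τ x = y := by
  obtain ⟨a, b, c, rfl⟩ := exists_kvec i₁ g Θ hΘ hΘi hU y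
  obtain ⟨χ, ψ', h1, h2⟩ := exists_resolvent_W hB hBi hm a c
  -- The solution is `φ₀ = χ - m Ḡ(m) ξ`, `ζ = m⁻¹ (ξ + b)`, `ψ = ψ' + G(m) ξ`. The three component
  -- equations hold for every `ξ`, because `Ā Ḡ(m) = -G(m)`; `Θ ζ = τ φ₀` is what determines `ξ`.
  obtain ⟨ξ, hξ⟩ := exists_charge hB hΘ H30 hm ((m : 𝕜) • τ χ - Θ b)
  have hm' : (m : 𝕜) ≠ 0 := by exact_mod_cast hm
  have hΘζ : Θ ((m : 𝕜)⁻¹ • (ξ + b)) = τ (χ - (m : 𝕜) • Gbar2 hB τ hm ξ) := by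
    rw [map_smul, inv_smul_eq_iff₀ hm', map_add, map_sub, map_smul, smul_sub, smul_smul,
      ← pow_two, eq_sub_iff_add_eq, add_right_comm, hξ, sub_add_cancel]
  obtain ⟨x, hx, hx'⟩ := (LinearPMap.mem_graph_iff _).1
    ((mem_graph_WTheta hB hΘ hΘi H32 hU hm hg _ _).2 ⟨_, ψ', _, ξ, hΘζ, rfl, rfl⟩)
  refine ⟨x, ?_⟩
  rw [hx', hx, smul_kvec_sub_kvec]
  congr 1
  · rw [← h1, map_sub, map_smul, incl_Gbar2, smul_sub, smul_smul, pow_two]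
    abel
  · rw [smul_smul, mul_inv_cancel₀ hm', one_smul, add_sub_cancel_left]
  · rw [← h2, map_sub, map_smul, Abar_Gbar2, smul_add, smul_neg]
    abel

theorem dense_WTheta_domain (hB : IsSelfAdjoint B) (hBi : ∀ x : B.domain, B x = 0 → x = 0)
    (hΘ : Θ.IsPositive) (hΘi : Function.Injective Θ) (hτ : DenseRange τ)
    (H30 : LinearMap.range (tauTheta τ Θ) = ⊤)
    (H31 : Set.range (tauStar hB τ) ∩ HNegOne hB = {0}) (H32 : IsCommonSpace B i₀ i₁)
    (hU : Function.Injective (sumMap i₁ g)) {l : ℝ} (hl : l ≠ 0) (hg : g = G hB τ i₀ i₁ hl) :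
    Dense ((WTheta i₀ i₁ g Θ hΘ hΘi hU τ).domain : Set (KTot i₁ g Θ hΘ hΘi hU)) := by
  have := completeSpace_Hbar2 hB
  refine dense_of_forall_dual_eq_zero _ fun F hF => ?_
  have hF' : ∀ (φ : Hbar2 B) (ζ : h) (ψ : B.domain), Θ ζ = τ φ →
      F (kvec i₁ g Θ hΘ hΘi hU (Hbar2.incl B φ) ζ ψ) = 0 := fun φ ζ ψ h0 => by
    obtain ⟨x, hx, -⟩ := (LinearPMap.mem_graph_iff _).1
      ((mem_graph_WTheta hB hΘ hΘi H32 hU hl hg _ _).2 ⟨φ, ψ, ζ, 0, h0, rfl, rfl⟩)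
    rw [map_zero, add_zero] at hx
    exact (congrArg F hx).symm.trans (hF x x.2)
  let F' : StrongDual 𝕜 (Hbar1 B × h × H) := F.comp (kvecL i₁ g Θ hΘ hΘi hU)
  have hsplit : ∀ φ ζ ψ, F' (φ, ζ, ψ) = F' (φ, ζ, 0) + F' (0, 0, ψ) := fun φ ζ ψ => by
    rw [← map_add]; simp
  -- The boundary condition does not involve `ψ`, so this component is free in `D(B)`.
  have hψ : ∀ ψ : H, F' (0, 0, ψ) = 0 := by
    have hc : Continuous fun ψ : H => F' (0, 0, ψ) := by fun_prop
    refine fun ψ => congrFun (hc.ext_on hB.dense_domain continuous_const fun x hx => ?_) ψ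
    have h0 := hF' 0 0 ⟨x, hx⟩ (by simp)
    rw [map_zero] at h0
    exact h0
  let E : StrongDual 𝕜 (Hbar2 B × h) := F'.comp
    (((inclL B).comp (ContinuousLinearMap.fst 𝕜 _ _)).prod
      ((ContinuousLinearMap.snd 𝕜 _ _).prod 0))
  have hE : ∀ φ ζ, E (φ, ζ) = F' (Hbar2.incl B φ, ζ, 0) := fun φ ζ => rfl
  -- The kernel of `τ φ - Θ ζ` is exactly the boundary condition.
  obtain ⟨f, hf⟩ := exists_dual_comp_of_ker (tauSub τ Θ) (tauSub_surjective H30) E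
    fun ⟨φ, ζ⟩ h0 => by
      rw [tauSub_apply, sub_eq_zero] at h0
      exact hF' φ ζ 0 h0.symm
  let κ := (InnerProductSpace.toDual 𝕜 h).symm f
  have hκ : ∀ y, inner 𝕜 κ y = f y := fun y => InnerProductSpace.toDual_symm_apply
  -- At `ζ = 0` the factorization reads `⟪κ, τ φ⟫ = F' (φ, 0, 0)`, which is bounded in the norm of
  -- `H̄₁`.
  have hκ0 : κ = 0 := eq_zero_of_tauStar hB hBi hτ H31
    (F'.comp (ContinuousLinearMap.inl 𝕜 (Hbar1 B) (h × H))) fun φ => by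
      have h0 := hf (φ, 0)
      rw [tauSub_apply, map_zero, sub_zero, ← hκ, hE] at h0
      exact h0.symm
  have hφ : ∀ ζ φ, F' (φ, ζ, 0) = 0 := by
    intro ζ
    have hc : Continuous fun φ : Hbar1 B => F' (φ, ζ, 0) := by fun_prop
    refine fun φ => congrFun (hc.ext_on (dense_hbar2 hB hBi) continuous_const fun φ hφ => ?_) φ
    have h0 := hf (Hbar2.mk φ hφ, ζ)
    rw [← hκ, hκ0, inner_zero_left] at h0
    exact h0
  ext x
  obtain ⟨φ, ζ, ψ, rfl⟩ := exists_kvec i₁ g Θ hΘ hΘi hU x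
  exact (hsplit φ ζ ψ).trans (by rw [hψ, hφ, add_zero]; rfl)

theorem WTheta_skew_symmetric (hB : IsSelfAdjoint B) (hΘ : Θ.IsPositive)
    (hΘi : Function.Injective Θ) (H32 : IsCommonSpace B i₀ i₁)
    (hU : Function.Injective (sumMap i₁ g)) {l : ℝ} (hl : l ≠ 0) (hg : g = G hB τ i₀ i₁ hl)
    (x y : (WTheta i₀ i₁ g Θ hΘ hΘi hU τ).domain) :
    inner 𝕜 (WTheta i₀ i₁ g Θ hΘ hΘi hU τ x) (y : KTot i₁ g Θ hΘ hΘi hU) =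
      -inner 𝕜 (x : KTot i₁ g Θ hΘ hΘi hU) (WTheta i₀ i₁ g Θ hΘ hΘi hU τ y) := by
  -- This is half of `⟪W_Θ x, y⟫`. Since `⟪Θ ξ, ζ⟫ = ⟪ξ, τ φ⟫`, `inner_tau` cancels the term in
  -- `Ḡ(l)` and leaves an expression that is minus the conjugate of the other half with `x`, `y`
  -- exchanged.
  have key : ∀ (φ : Hbar2 B) (ψ' : B.domain) (ζ ξ : h), Θ ζ = τ φ →
      inner 𝕜 (toHbar1 B ψ' - ((l : 𝕜) ^ 2) • Gbar hB τ hl ξ) (Hbar2.incl B φ)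
        + inner 𝕜 (Θ ξ) ζ = -inner 𝕜 ((ψ' : H) + Gl hB τ hl ξ) (Abar B φ) := by
    intro φ ψ' ζ ξ h0
    have hs : inner 𝕜 (Θ ξ) ζ = inner 𝕜 ξ (Θ ζ) := hΘ.isSymmetric ξ ζ
    rw [hs, h0, inner_tau hB τ hl, inner_sub_left, inner_smul_left, inner_toHbar1 hB,
      inner_add_left]
    simp only [map_pow, RCLike.conj_ofReal]
    ring
  obtain ⟨φ, ψ, ζ, ξ, h1, h2, h3⟩ := (mem_graph_WTheta hB hΘ hΘi H32 hU hl hg _ _).1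
    ((WTheta i₀ i₁ g Θ hΘ hΘi hU τ).mem_graph x)
  obtain ⟨φ', ψ', ζ', ξ', h1', h2', h3'⟩ := (mem_graph_WTheta hB hΘ hΘi H32 hU hl hg _ _).1
    ((WTheta i₀ i₁ g Θ hΘ hΘi hU τ).mem_graph y)
  rw [h2, h3, h2', h3', inner_kvec, key φ' ψ ζ' ξ h1', ← inner_conj_symm (kvec _ _ _ _ _ _ _ _ _),
    inner_kvec, key φ ψ' ζ ξ' h1]
  simp

/-- The resolvent equation is needed at `1` and `-1`, each with its own representation of `g`; hence
`hg` for all `m`. -/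
theorem isSkewAdjoint_WTheta (hB : IsSelfAdjoint B) (hBi : ∀ x : B.domain, B x = 0 → x = 0)
    (hΘ : Θ.IsPositive) (hΘi : Function.Injective Θ) (hτ : DenseRange τ)
    (H30 : LinearMap.range (tauTheta τ Θ) = ⊤)
    (H31 : Set.range (tauStar hB τ) ∩ HNegOne hB = {0}) (H32 : IsCommonSpace B i₀ i₁)
    {l : ℝ} (hl : l ≠ 0) (hU : Function.Injective (sumMap i₁ g))
    (hg : ∀ (m : ℝ) (hm : m ≠ 0), g = G hB τ i₀ i₁ hm) :
    IsSkewAdjoint (WTheta i₀ i₁ g Θ hΘ hΘi hU τ) := by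
  refine isSkewAdjoint_of_surjective _
    (dense_WTheta_domain hB hBi hΘ hΘi hτ H30 H31 H32 hU hl (hg l hl))
    (WTheta_skew_symmetric hB hΘ hΘi H32 hU hl (hg l hl)) ?_ ?_
  · intro y
    simpa using surjective_sub_WTheta hB hBi hΘ hΘi H30 H32 hU one_ne_zero (hg 1 one_ne_zero) y
  · intro y
    have h1 : (-1 : ℝ) ≠ 0 := by norm_num
    obtain ⟨x, hx⟩ := surjective_sub_WTheta hB hBi hΘ hΘi H30 H32 hU h1 (hg _ h1) (-y)
    refine ⟨x, ?_⟩
    rw [← neg_inj, ← hx]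
    simp
    abel

/-- Single-valuedness is the point: if `ψ' + G(l) ξ = 0`, then `G(l) ξ` is in `D(B)`, so `ξ = 0` and
`ψ' = 0`. -/
theorem WTilde_graph (hB : IsSelfAdjoint B) (hBi : ∀ x : B.domain, B x = 0 → x = 0)
    (hΘ : Θ.IsPositive) (hΘi : Function.Injective Θ) (hτ : DenseRange τ)
    (H31 : Set.range (tauStar hB τ) ∩ HNegOne hB = {0}) {l : ℝ} (hl : l ≠ 0) :
    (WTilde hB τ Θ hΘ hΘi hl).graph = WTildeGraph hB τ Θ hΘ hΘi hl := by
  refine Submodule.toLinearPMap_graph_eq _ ?_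
  rintro ⟨x, y⟩ ⟨φ₀, ψ', ζ, ξ, h1, h2, h3⟩ h0
  simp only at h0 h2 h3
  rw [h0] at h2
  have e1 : Hbar2.incl B φ₀ = 0 := (congrArg (fun z : HTot B Θ hΘ hΘi => z.fst) h2).symm
  have e2 : (ψ' : H) + Gl hB τ hl ξ = 0 :=
    (congrArg (fun z : HTot B Θ hΘ hΘi => z.snd.fst) h2).symm
  have e3 : φ₀ = 0 := Subtype.ext e1
  have e4 : Gl hB τ hl ξ = ((-ψ' : B.domain) : H) := (neg_eq_of_add_eq_zero_right e2).symm
  have e5 : ξ = 0 := eq_zero_of_Gl_mem hB hBi hτ H31 hl (by rw [e4]; exact (-ψ').2)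
  have e6 : ψ' = 0 := Subtype.ext (by simpa [e5] using e2)
  change y = 0
  rw [h3, e3, e5, e6]
  simp

theorem WTheta_graph_eq_map (hB : IsSelfAdjoint B) (hΘ : Θ.IsPositive)
    (hΘi : Function.Injective Θ) (H32 : IsCommonSpace B i₀ i₁) {l : ℝ} (hl : l ≠ 0)
    (hU : Function.Injective (sumMap i₁ (G hB τ i₀ i₁ hl))) :
    (WTheta i₀ i₁ (G hB τ i₀ i₁ hl) Θ hΘ hΘi hU τ).graph =
      (WTildeGraph hB τ Θ hΘ hΘi hl).map
        ((unitary i₁ (G hB τ i₀ i₁ hl) Θ hΘ hΘi hU).toLinearEquiv.toLinearMap.prodMap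
          (unitary i₁ (G hB τ i₀ i₁ hl) Θ hΘ hΘi hU).toLinearEquiv.toLinearMap) := by
  ext ⟨x, y⟩
  rw [mem_graph_WTheta hB hΘ hΘi H32 hU hl rfl, Submodule.mem_map]
  constructor
  · rintro ⟨φ₀, ψ', ζ, ξ, h1, rfl, rfl⟩
    exact ⟨(_, _), ⟨φ₀, ψ', ζ, ξ, h1, rfl, rfl⟩, rfl⟩
  · rintro ⟨⟨p, q⟩, ⟨φ₀, ψ', ζ, ξ, h1, h2, h3⟩, h4⟩
    refine ⟨φ₀, ψ', ζ, ξ, h1, ?_, ?_⟩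
    · rw [← unitary_apply, ← h2]
      exact (congrArg Prod.fst h4).symm
    · rw [← unitary_apply, ← h3]
      exact (congrArg Prod.snd h4).symm

/-- A vector of `H̄₁` has charge zero, so the boundary condition reduces to `τ φ = 0`. -/
theorem mem_domain_iff {hΘ : Θ.IsPositive} {hΘi : Function.Injective Θ}
    (H32 : IsCommonSpace B i₀ i₁) (hU : Function.Injective (sumMap i₁ g))
    (x : WithLp 2 (Hbar1 B × H)) :
    (x ∈ (W B).domain ∧
        incl i₁ g Θ hΘ hΘi hU x ∈ (WTheta i₀ i₁ g Θ hΘ hΘi hU τ).domain) ↔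
      (∃ φ : Hbar2 B, τ φ = 0 ∧ Hbar2.incl B φ = x.fst) ∧ x.snd ∈ B.domain := by
  have hr := Kbar1.reg_equiv i₁ g Θ hΘ hΘi hU (x.fst, 0)
  have hc := Kbar1.charge_equiv i₁ g Θ hΘ hΘi hU (x.fst, 0)
  constructor
  · rintro ⟨hx, ⟨φ, h1, h2⟩, -⟩
    exact ⟨⟨φ, h2.symm.trans ((congrArg Θ hc).trans (map_zero Θ)), h1.trans hr⟩, hx.2⟩
  · rintro ⟨⟨φ, h1, h2⟩, h3⟩
    have h4 : x.fst ∈ hbar2 B := h2 ▸ φ.2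
    refine ⟨⟨h4, h3⟩, ⟨φ, h2.trans hr.symm,
      (congrArg Θ hc).trans ((map_zero Θ).trans h1.symm)⟩, ⟨(toHbar1 B ⟨x.snd, h3⟩, 0), ?_⟩⟩
    exact (by simp [sumMap] : _ = _).trans (H32.compat ⟨x.snd, h3⟩).symm

theorem WTheta_incl {hΘ : Θ.IsPositive} {hΘi : Function.Injective Θ}
    (H32 : IsCommonSpace B i₀ i₁) (hU : Function.Injective (sumMap i₁ g))
    (x : WithLp 2 (Hbar1 B × H)) (hx : x ∈ (W B).domain)
    (hx' : incl i₁ g Θ hΘ hΘi hU x ∈ (WTheta i₀ i₁ g Θ hΘ hΘi hU τ).domain) :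
    WTheta i₀ i₁ g Θ hΘ hΘi hU τ ⟨_, hx'⟩ = incl i₁ g Θ hΘ hΘi hU (W B ⟨x, hx⟩) := by
  refine WithLp.ofLp_injective 2 (Prod.ext ?_ ?_)
  · refine Kbar1.mk_sumMap i₁ g Θ hΘ hΘi hU _ (toHbar1 B ⟨x.snd, hx.2⟩, 0) ?_
    exact (H32.compat ⟨x.snd, hx.2⟩).trans (by simp [sumMap])
  · exact congrArg (Abar B) (Subtype.ext (Kbar1.reg_equiv i₁ g Θ hΘ hΘi hU (x.fst, 0)))

/-- The density argument for `D(W_Θ)` with `τ` alone in place of `τ φ - Θ ζ`: a functional on `H̄₁`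
vanishing on `Ker τ` is `τ* κ` on `H̄₂`, so `κ = 0`. -/
theorem dense_ker_tau (hB : IsSelfAdjoint B) (hBi : ∀ x : B.domain, B x = 0 → x = 0)
    (hτ : DenseRange τ) (H31 : Set.range (tauStar hB τ) ∩ HNegOne hB = {0})
    (hs : Function.Surjective τ) :
    Dense {x : WithLp 2 (Hbar1 B × H) |
      (∃ φ : Hbar2 B, τ φ = 0 ∧ Hbar2.incl B φ = x.fst) ∧ x.snd ∈ B.domain} := by
  have := completeSpace_Hbar2 hB
  refine dense_prod_toLp (𝕜 := 𝕜) (s := {φ₁ | ∃ φ : Hbar2 B, τ φ = 0 ∧ Hbar2.incl B φ = φ₁})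
    ?_ hB.dense_domain
  refine dense_of_forall_dual_eq_zero ((LinearMap.ker τ.toLinearMap).map (Hbar2.incl B))
    fun F hF => ?_
  obtain ⟨f, hf⟩ := exists_dual_comp_of_ker τ hs (F.comp (inclL B)) fun φ h0 =>
    hF _ ⟨φ, h0, rfl⟩
  let κ := (InnerProductSpace.toDual 𝕜 h).symm f
  have hκ : ∀ y, inner 𝕜 κ y = f y := fun y => InnerProductSpace.toDual_symm_apply
  have hκ0 : κ = 0 := eq_zero_of_tauStar hB hBi hτ H31 F fun φ => by
    rw [hκ, ← hf]; rfl
  refine ContinuousLinearMap.coeFn_injective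
    (F.continuous.ext_on (dense_hbar2 hB hBi) continuous_const fun φ hφ => ?_)
  have h0 := hf (Hbar2.mk φ hφ)
  rw [← hκ, hκ0, inner_zero_left] at h0
  exact h0

end SkewAdjointness

end AbstractWave

end

open AbstractWave in
theorem theorem3p6 {𝕜 H h V : Type*} [RCLike 𝕜]
    [NormedAddCommGroup H] [InnerProductSpace 𝕜 H] [CompleteSpace H]
    [NormedAddCommGroup h] [InnerProductSpace 𝕜 h] [CompleteSpace h]
    [AddCommGroup V] [Module 𝕜 V]
    -- the injective self-adjoint operator `B`
    (B : H →ₗ.[𝕜] H) (hB : IsSelfAdjoint B) (hBi : ∀ x : B.domain, B x = 0 → x = 0)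
    -- the bounded, positive and injective self-adjoint operator `Θ`
    (Θ : h →L[𝕜] h) (hΘ : Θ.IsPositive) (hΘi : Function.Injective Θ)
    (τ : Hbar2 B →L[𝕜] h) (hτ : DenseRange τ)
    (H30 : LinearMap.range (tauTheta τ Θ) = ⊤)
    (H31 : Set.range (tauStar hB τ) ∩ HNegOne hB = {0})
    (i₀ : H →ₗ[𝕜] V) (i₁ : Hbar1 B →ₗ[𝕜] V) (H32 : IsCommonSpace B i₀ i₁)
    (l : ℝ) (hl : l ≠ 0) :
    -- the map `G` does not depend on `l`
    (∀ (m : ℝ) (hm : m ≠ 0), G hB τ i₀ i₁ hm = G hB τ i₀ i₁ hl) ∧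
    -- the decomposition `φ = φ₀ + G ζ` is unique
    ∃ hU : Function.Injective (sumMap i₁ (G hB τ i₀ i₁ hl)),
      -- `W_Θ` is skew-adjoint, its resolvent exists at every real `m ≠ 0`, and the space on which
      -- it acts is complete if `Θ` is surjective
      IsSkewAdjoint (WTheta i₀ i₁ (G hB τ i₀ i₁ hl) Θ hΘ hΘi hU τ) ∧
      (∀ m : ℝ, m ≠ 0 → ∀ y, ∃ x : (WTheta i₀ i₁ (G hB τ i₀ i₁ hl) Θ hΘ hΘi hU τ).domain,
        (m : 𝕜) • (x : KTot i₁ (G hB τ i₀ i₁ hl) Θ hΘ hΘi hU) -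
          WTheta i₀ i₁ (G hB τ i₀ i₁ hl) Θ hΘ hΘi hU τ x = y) ∧
      (Function.Surjective Θ → CompleteSpace (KTot i₁ (G hB τ i₀ i₁ hl) Θ hΘ hΘi hU)) ∧
      -- `W_Θ = U W̃_Θ U*`, with the unitary map `U(φ₀, ψ, ζ) = (φ₀ + G ζ, ψ)`
      (WTilde hB τ Θ hΘ hΘi hl).graph = WTildeGraph hB τ Θ hΘ hΘi hl ∧
      (∃ U : HTot B Θ hΘ hΘi ≃ₗᵢ[𝕜] KTot i₁ (G hB τ i₀ i₁ hl) Θ hΘ hΘi hU,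
        (∀ (φ₀ : Hbar1 B) (ψ : H) (ζ : h),
          U (WithLp.toLp 2 (φ₀, WithLp.toLp 2 (ψ, (HTheta.val Θ hΘ hΘi).symm ζ))) =
            WithLp.toLp 2 (Kbar1.mk i₁ (G hB τ i₀ i₁ hl) Θ hΘ hΘi hU
              (i₁ φ₀ + G hB τ i₀ i₁ hl ζ) ⟨(φ₀, ζ), rfl⟩, ψ)) ∧
        (WTheta i₀ i₁ (G hB τ i₀ i₁ hl) Θ hΘ hΘi hU τ).graph =
          (WTilde hB τ Θ hΘ hΘi hl).graph.map
            (U.toLinearEquiv.toLinearMap.prodMap U.toLinearEquiv.toLinearMap)) ∧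
      -- the inclusion of `H̄₁ ⊕ H` in `K̄₁ ⊕ H` is isometric
      (∀ x, ‖incl i₁ (G hB τ i₀ i₁ hl) Θ hΘ hΘi hU x‖ = ‖x‖) ∧
      -- `D(W) ∩ D(W_Θ) = Ker τ ⊕ H₁`
      (∀ x : WithLp 2 (Hbar1 B × H),
        (x ∈ (W B).domain ∧ incl i₁ (G hB τ i₀ i₁ hl) Θ hΘ hΘi hU x ∈
            (WTheta i₀ i₁ (G hB τ i₀ i₁ hl) Θ hΘ hΘi hU τ).domain) ↔
          (∃ φ : Hbar2 B, τ φ = 0 ∧ Hbar2.incl B φ = x.fst) ∧ x.snd ∈ B.domain) ∧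
      -- `W` and `W_Θ` coincide there
      (∀ (x : WithLp 2 (Hbar1 B × H)) (hx : x ∈ (W B).domain)
        (hx' : incl i₁ (G hB τ i₀ i₁ hl) Θ hΘ hΘi hU x ∈
          (WTheta i₀ i₁ (G hB τ i₀ i₁ hl) Θ hΘ hΘi hU τ).domain),
        WTheta i₀ i₁ (G hB τ i₀ i₁ hl) Θ hΘ hΘi hU τ ⟨_, hx'⟩ =
          incl i₁ (G hB τ i₀ i₁ hl) Θ hΘ hΘi hU (W B ⟨x, hx⟩)) ∧
      -- `W_Θ` is a singular perturbation of `W` if `Ker τ ⊕ H₁` is dense in `H̄₁ ⊕ H`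
      (Dense {x : WithLp 2 (Hbar1 B × H) |
          (∃ φ : Hbar2 B, τ φ = 0 ∧ Hbar2.incl B φ = x.fst) ∧ x.snd ∈ B.domain} →
        IsSingularPerturbation (incl i₁ (G hB τ i₀ i₁ hl) Θ hΘ hΘi hU) (W B)
          (WTheta i₀ i₁ (G hB τ i₀ i₁ hl) Θ hΘ hΘi hU τ)) ∧
      -- and `Ker τ ⊕ H₁` is dense if `τ` is surjective
      (Function.Surjective τ →
        Dense {x : WithLp 2 (Hbar1 B × H) |
          (∃ φ : Hbar2 B, τ φ = 0 ∧ Hbar2.incl B φ = x.fst) ∧ x.snd ∈ B.domain}) := by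
  have hU := sumMap_injective hB hBi hτ H31 H32 hl
  have hg : ∀ (m : ℝ) (hm : m ≠ 0), G hB τ i₀ i₁ hl = G hB τ i₀ i₁ hm :=
    fun m hm => G_eq_G hB hBi τ H32 hm hl
  have hskew := isSkewAdjoint_WTheta hB hBi hΘ hΘi hτ H30 H31 H32 hl hU hg
  have hdom := fun x => mem_domain_iff (hΘ := hΘ) (hΘi := hΘi) (τ := τ) H32 hU x
  have hcoin := fun x hx hx' => WTheta_incl (hΘ := hΘ) (hΘi := hΘi) (τ := τ) H32 hU x hx hx'
  have hgraph := WTilde_graph hB hBi hΘ hΘi hτ H31 hl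
  refine ⟨fun m hm => G_eq_G hB hBi τ H32 hl hm, hU, hskew,
    fun m hm y => surjective_sub_WTheta hB hBi hΘ hΘi H30 H32 hU hm (hg m hm) y,
    completeSpace_KTot i₁ _ Θ hΘ hΘi hU, hgraph,
    ⟨unitary i₁ _ Θ hΘ hΘi hU, fun φ₀ ψ ζ => ?_, ?_⟩, norm_incl i₁ _ Θ hΘ hΘi hU, hdom, hcoin,
    fun hd => ⟨isSkewAdjoint_W hB hBi, hskew, hd.mono fun x hx => ?_⟩,
    dense_ker_tau hB hBi hτ H31⟩
  · exact (congrArg (fun k => WithLp.toLp 2 (k, ψ))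
      (Kbar1.mk_sumMap i₁ _ Θ hΘ hΘi hU _ (φ₀, ζ) (by simp [sumMap]))).symm
  · rw [hgraph]
    exact WTheta_graph_eq_map hB hΘ hΘi H32 hl hU
  · obtain ⟨h1, h2⟩ := (hdom x).2 hx
    exact ⟨h1, h2, hcoin x h1 h2⟩
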